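/- **Conventions.** All graphs are finite mixed graphs $\mathfrak G=(\mathcal I,\mathcal V,\mathcal E)$ with disjoint sets of input nodes $\mathcal I$ and output nodes $\mathcal V$, without self-loops; each edge carries at each of its two ends a mark: tail, arrowhead or circle. A star $*$ stands for an arbitrary mark; $a\,{-}\,b$ is an edge with two tails. Walks and paths (walks without repeated nodes) come with a choice of edges; a non-endnode of a walk is a *collider* if both adjacent edges have an arrowhead at it. $\mathrm{Anc}_{\mathfrak G}(X)$ is the set of nodes with a directed path (possibly of length $0$) to $X$; $\mathrm{PoAn}_{\mathfrak G}(X)$ is the set of nodes $v$ with a path (possibly of length $0$) from $v$ to $X$, none of whose edges has, in the direction of travel, an arrowhead at its first node or a tail at its second node. For a set $\mathcal S$ of nodes, an *$\mathcal S$-inducing path* from $a$ to $b\ne a$ is a path on which every non-endnode is a collider and lies in $\mathrm{Anc}_{\mathfrak G}(\{a,b\}\cup\mathcal S)$. An *iMAG* is such a graph $\mathfrak M$ with only tail and arrowhead marks, with at most one edge between two nodes, no arrowhead at an input node, no edge between input nodes, no directed cycle, no almost directed cycle $a\to\cdots\to b\leftrightarrow a$, no triple $a\,{*\!\!\to}\,b\,{-}\,c$,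 and no $\emptyset$-inducing path between distinct non-adjacent nodes. An *isADMG* $\mathfrak A$ is a graph with only directed and bidirected edges (possibly several between two nodes), no arrowhead at an input node and no directed cycle, together with a set $\mathcal S_{\mathfrak A}$ of selection nodes among its output nodes. $\mathfrak M=(\mathcal I,\mathcal V,\mathcal E)$ *represents* $\mathfrak A$, written $\mathfrak A\in[\mathfrak M]_{\mathsf G}$, if $\mathfrak A$ has input nodes $\mathcal I$ and non-selection output nodes $\mathcal V$; distinct $a,b\in\mathcal I\cup\mathcal V$ are adjacent in $\mathfrak M$ iff $\{a,b\}\not\subseteq\mathcal I$ and there is an $\mathcal S_{\mathfrak A}$-inducing path from $a$ to $b$ in $\mathfrak A$; and for every edge of $\mathfrak M$ between $a$ and $b$, an arrowhead at $a$ implies $a\notin\mathrm{Anc}_{\mathfrak A}(\{b\}\cup\mathcal S_{\mathfrak A})$ and a tail at $a$ implies $a\in\mathrm{Anc}_{\mathfrak A}(\{b\}\cup\mathcal S_{\mathfrak A})$. A directed edge $a\to b$ of $\mathfrak M$ is *visible* if $a\in\mathcal I$, or if there is a node $c$ not adjacent to $b$ with an edge $c\,{*\!\!\to}\,a$ or a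 path $c\,{*\!\!\to}\,v_1\leftrightarrow\cdots\leftrightarrow v_{n-1}\leftrightarrow a$ ($n\ge2$) such that all $v_i$ are parents of $b$; otherwise it is *invisible*. **Manipulations.** Let $D,T\subseteq\mathcal V$ be disjoint. For both kinds of graphs, $\mathfrak G_{\mathsf{do}(I_D,T)}$ arises by first applying the soft manipulation of $D$, then the hard manipulation of $T$. - *isADMG:* the soft manipulation adds for each $d\in D$ a new input node $I_d$ and the edge $I_d\to d$; the hard manipulation turns the nodes of $T$ into input nodes and deletes all edges with an arrowhead at a node of $T$. - *iMAG:* the soft manipulation adds for each $d\in D$ a new input node $I_d$, an edge between $I_d$ and $d$ with a tail at $I_d$ and, at $d$, an arrowhead if some edge of $\mathfrak M$ has an arrowhead at $d$, a tail if $\mathfrak M$ has an undirected edge at $d$, and a circle if neither holds; furthermore an edge $I_d\to b$ for every invisible $d\to b$ in $\mathfrak M$, and an edge $I_d\,{-}\,b$ for every $d\,{-}\,b$ in $\mathfrak M$ with $b\in\mathcal V$. The hard manipulation turns the nodes of $T$ into input nodes and deletes all edges with an arrowhead at a node of $T$ and all edges between two (new or old) input nodes. **Separation.** Let $\mathfrak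 H=\mathfrak G_{\mathsf{do}(I_D,T)}$, where $\mathfrak G=(\mathcal I,\mathcal V_{\mathfrak G},\mathcal E)$ is an iMAG or isADMG (in the second case $\mathcal V_{\mathfrak G}$ contains the selection nodes), and let $C$ be a set of nodes of $\mathfrak H$. A walk $v_0,\dots,v_n$ ($n\ge0$) in $\mathfrak H$ is *$id$-open given $C$* if $v_0,v_n\notin C$ and every non-endnode $v_i$ satisfies one of the following, where "marks" are the marks at $v_i$ on the edges from $v_{i-1}$ and to $v_{i+1}$: - at least one mark is a tail, and $v_i\notin C$; - both marks are circles, $v_{i-1}$ and $v_{i+1}$ are distinct and non-adjacent, and $v_i\notin C$; - both marks are arrowheads, none of $v_{i-1},v_i,v_{i+1}$ is in $\{I_d\}_{d\in D}$, and $v_i\in\mathrm{Anc}_{\mathfrak H}(C)$; - both marks are arrowheads, one of $v_{i-1},v_i,v_{i+1}$ is in $\{I_d\}_{d\in D}$, and $v_i\in\mathrm{PoAn}_{\mathfrak H}(C\cap\mathcal V_{\mathfrak G})$; - one mark is a circle, on the edge joining $v_i$ to a neighbour on the walk that is in $\{I_d\}_{d\in D}$, the other mark is an arrowhead, and $v_i\in\mathrm{PoAn}_{\mathfrak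 H}(C\cap\mathcal V_{\mathfrak G})$. $A\overset{id}{\underset{\mathfrak H}{\perp}}B\mid C$ means that no walk in $\mathfrak H$ from a node of $A$ to a node of $B\cup\mathcal I\cup\{I_d\}_{d\in D}\cup T$ is $id$-open given $C$. **Theorem.** Let $\mathfrak M=(\mathcal I,\mathcal V,\mathcal E)$ be an iMAG and let $D,T\subseteq\mathcal V$ be disjoint. Let $A\subseteq\mathcal V\setminus T$ and $B,C\subseteq\mathcal I\cup\{I_d\}_{d\in D}\cup\mathcal V$ be such that $A,B,C$ are pairwise disjoint. Then $$A\overset{id}{\underset{\mathfrak M_{\mathsf{do}(I_D,T)}}{\perp}}B\mid C\cup T\quad\Longleftrightarrow\quad\forall\,\mathfrak A\in[\mathfrak M]_{\mathsf G}:\ A\overset{id}{\underset{\mathfrak A_{\mathsf{do}(I_D,T)}}{\perp}}B\mid C\cup T\cup\mathcal S_{\mathfrak A}.$$ -/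

import Mathlib

/-- The three possible marks of an edge at one of its end nodes. -/
inductive Mark where
  | tail
  | arrow
  | circle

/-- A (finite) mixed graph with input and output nodes; nodes are taken from a set `α` of labels.
`edge a m n b` says that there is an edge between `a` and `b` whose mark at `a` is `m` and
whose mark at `b` is `n`.  Several edges with different marks may join the same two nodes. -/
structure MixedGraph (α : Type*) where
  inputs : Set α
  outputs : Set α
  edge : α → Mark → Mark → α → Prop
  finite_inputs : inputs.Finite
  finite_outputs : outputs.Finite
  disjoint : Disjoint inputs outputs
  edge_symm : ∀ {a m n b}, edge a m n b → edge b n m a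
  edge_ne : ∀ {a m n b}, edge a m n b → a ≠ b
  edge_mem : ∀ {a m n b}, edge a m n b → a ∈ inputs ∪ outputs

namespace MixedGraph

variable {α : Type*}

/-- All nodes of the graph. -/
def nodes (G : MixedGraph α) : Set α := G.inputs ∪ G.outputs

/-- Two nodes are adjacent if some edge joins them. -/
def Adj (G : MixedGraph α) (a b : α) : Prop := ∃ m n, G.edge a m n b

/-- `a → b` is in `G`. -/
def Directed (G : MixedGraph α) (a b : α) : Prop := G.edge a Mark.tail Mark.arrow b

/-- `a ↔ b` is in `G`. -/
def Bidirected (G : MixedGraph α) (a b : α) : Prop := G.edge a Mark.arrow Mark.arrow b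

/-- `a — b` is in `G`. -/
def Undirected (G : MixedGraph α) (a b : α) : Prop := G.edge a Mark.tail Mark.tail b

/-- `G` has an edge between `a` and `b` with an arrowhead at `a` (and any mark at `b`). -/
def ArrowAt (G : MixedGraph α) (a b : α) : Prop := ∃ n, G.edge a Mark.arrow n b

/-- `G` has an edge between `a` and `b` with a tail at `a` (and any mark at `b`). -/
def TailAt (G : MixedGraph α) (a b : α) : Prop := ∃ n, G.edge a Mark.tail n b

/-- The ancestors of the nodes of `X`, the nodes of `X` included. -/
def Anc (G : MixedGraph α) (X : Set α) : Set α :=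
  {a | ∃ x ∈ X, Relation.ReflTransGen G.Directed a x}

/-- An edge `a ⋆—⋆ b` that may be traversed by a potentially directed path from `a` to `b`: it has
no arrowhead at `a` and no tail at `b`. -/
def PoDirected (G : MixedGraph α) (a b : α) : Prop :=
  ∃ m n, G.edge a m n b ∧ m ≠ Mark.arrow ∧ n ≠ Mark.tail

/-- The possible ancestors of the nodes of `X`, the nodes of `X` included. -/
def PoAn (G : MixedGraph α) (X : Set α) : Set α :=
  {a | ∃ x ∈ X, Relation.ReflTransGen G.PoDirected a x}

/-- A walk: nodes `node 0, …, node length` and, for each `i < length`, a chosen edge between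
`node i` and `node (i + 1)`, whose mark at `node i` is `fst i` and whose mark at `node (i + 1)`
is `snd i`.  The values of `node`, `fst`, `snd` at larger indices are irrelevant. -/
structure Walk (G : MixedGraph α) where
  length : ℕ
  node : ℕ → α
  fst : ℕ → Mark
  snd : ℕ → Mark
  node_zero_mem : node 0 ∈ G.nodes
  edge : ∀ i < length, G.edge (node i) (fst i) (snd i) (node (i + 1))

namespace Walk

variable {G : MixedGraph α}

/-- A path is a walk without repeated nodes. -/
def IsPath (π : G.Walk) : Prop :=
  ∀ i ≤ π.length, ∀ j ≤ π.length, π.node i = π.node j → i = j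

/-- The walk leads from `a` to `b`. -/
def FromTo (π : G.Walk) (a b : α) : Prop := π.node 0 = a ∧ π.node π.length = b

/-- The non-endnode `node (i + 1)` (where `i + 1 < length`) is a collider on the walk. -/
def ColliderAt (π : G.Walk) (i : ℕ) : Prop :=
  π.snd i = Mark.arrow ∧ π.fst (i + 1) = Mark.arrow

end Walk

/-- There is an `S`-inducing path from `a` to `b`: every non-endnode on it is a collider and lies
in `Anc ({a, b} ∪ S)`. -/
def HasInducingPath (G : MixedGraph α) (S : Set α) (a b : α) : Prop :=
  ∃ π : G.Walk, π.IsPath ∧ π.FromTo a b ∧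
    ∀ i, i + 1 < π.length → π.ColliderAt i ∧ π.node (i + 1) ∈ G.Anc ({a, b} ∪ S)

/-- Partial ancestral graphs with inputs. -/
structure IsIPAG (G : MixedGraph α) : Prop where
  /-- at most one edge between two nodes -/
  simple : ∀ {a b m n m' n'}, G.edge a m n b → G.edge a m' n' b → m = m' ∧ n = n'
  /-- no arrowheads towards input nodes -/
  no_arrow_input : ∀ {a b}, a ∈ G.inputs → ¬ G.ArrowAt a b
  /-- no edges between input nodes -/
  no_edge_input : ∀ {a b}, a ∈ G.inputs → b ∈ G.inputs → ¬ G.Adj a b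
  /-- no directed cycles -/
  no_directed_cycle : ∀ a, ¬ Relation.TransGen G.Directed a a
  /-- no almost directed cycles `a → ⋯ → b ↔ a` -/
  no_almost_directed_cycle : ∀ a b, Relation.TransGen G.Directed a b → ¬ G.Bidirected b a
  /-- no triples with an arrowhead at `b` (from `a`) and an undirected edge `b — c` -/
  no_arrow_undirected : ∀ a b c, G.ArrowAt b a → ¬ G.Undirected b c
  /-- no inducing path between distinct non-adjacent nodes -/
  maximal : ∀ a ∈ G.nodes, ∀ b ∈ G.nodes, a ≠ b → ¬ G.Adj a b → ¬ G.HasInducingPath ∅ a b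

/-- Maximal ancestral graphs with inputs: iPAGs without circle marks. -/
structure IsIMAG (G : MixedGraph α) : Prop extends G.IsIPAG where
  no_circle : ∀ {a m n b}, G.edge a m n b → m ≠ Mark.circle ∧ n ≠ Mark.circle

/-- Acyclic directed mixed graphs with inputs: all edges are directed or bidirected, there are no
arrowheads towards input nodes (so no edges between input nodes either), and there are no directed
cycles. -/
structure IsIADMG (G : MixedGraph α) : Prop where
  edge_type : ∀ {a m n b}, G.edge a m n b →
    (m = Mark.tail ∧ n = Mark.arrow) ∨ (m = Mark.arrow ∧ n = Mark.tail) ∨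
      (m = Mark.arrow ∧ n = Mark.arrow)
  no_arrow_input : ∀ {a b}, a ∈ G.inputs → ¬ G.ArrowAt a b
  acyclic : ∀ a, ¬ Relation.TransGen G.Directed a a

end MixedGraph

/-- An isADMG: an ADMG with input nodes, some of whose output nodes are (latent) selection nodes;
the other output nodes are observed. -/
structure ISADMG (α : Type*) where
  graph : MixedGraph α
  isIADMG : graph.IsIADMG
  sel : Set α
  sel_subset : sel ⊆ graph.outputs

namespace ISADMG

variable {α : Type*}

/-- The observed output nodes. -/
def observed (𝔄 : ISADMG α) : Set α := 𝔄.graph.outputs \ 𝔄.sel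

end ISADMG

namespace MixedGraph

variable {α : Type*}

/-- The iPAG `P` represents the isADMG `𝔄`. -/
structure Represents (P : MixedGraph α) (𝔄 : ISADMG α) : Prop where
  inputs_eq : 𝔄.graph.inputs = P.inputs
  outputs_eq : P.outputs = 𝔄.observed
  adj_iff : ∀ a ∈ P.nodes, ∀ b ∈ P.nodes, a ≠ b →
    (P.Adj a b ↔ ¬ (a ∈ P.inputs ∧ b ∈ P.inputs) ∧ 𝔄.graph.HasInducingPath 𝔄.sel a b)
  arrow : ∀ a b, P.ArrowAt a b → a ∉ 𝔄.graph.Anc ({b} ∪ 𝔄.sel)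
  tail : ∀ a b, P.TailAt a b → a ∈ 𝔄.graph.Anc ({b} ∪ 𝔄.sel)

/-- Visibility of a directed edge `a → b`: either `a` is an input node, or some node `c` that is not
adjacent to `b` has an edge into `a` (this is the case `length = 1` below) or a collider path
`c ⋆→ v₁ ↔ ⋯ ↔ vₙ₋₁ ↔ a` into `a` all of whose non-endnodes are parents of `b`. -/
def Visible (G : MixedGraph α) (a b : α) : Prop :=
  a ∈ G.inputs ∨
    (a ∈ G.outputs ∧ ∃ c ∈ G.nodes, ¬ G.Adj c b ∧
      ∃ π : G.Walk, π.IsPath ∧ π.FromTo c a ∧ 1 ≤ π.length ∧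
        (∀ i < π.length, π.snd i = Mark.arrow) ∧
        ∀ i, 1 ≤ i → i < π.length → π.fst i = Mark.arrow ∧ G.Directed (π.node i) b)

end MixedGraph

/-- The node labels of manipulated graphs: the labels of the original nodes, and for each label `a`
a new label for the intervention node `I_a`. -/
inductive Node (α : Type*) where
  | base (a : α)
  | int (a : α)

namespace Node

variable {α : Type*}

/-- Being an intervention node `I_a`. -/
def IsInt : Node α → Prop
  | base _ => False
  | int _ => True

end Node

namespace MixedGraph

variable {α : Type*}

/-- Adds to `G` the input nodes `I_a` for `a ∈ X ∩ outputs`, with an edge between `I_a` and `b`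
with a tail at `I_a` and the mark `n` at `b` whenever `new a n b`. -/
def addInt (G : MixedGraph α) (X : Set α) (new : α → Mark → α → Prop)
    (hnew : ∀ a n b, new a n b → b ∈ G.outputs) : MixedGraph (Node α) where
  inputs := Node.base '' G.inputs ∪ Node.int '' (X ∩ G.outputs)
  outputs := Node.base '' G.outputs
  edge
    | .base a, m, n, .base b => G.edge a m n b
    | .int a, m, n, .base b => a ∈ X ∩ G.outputs ∧ m = Mark.tail ∧ new a n b
    | .base b, n, m, .int a => a ∈ X ∩ G.outputs ∧ m = Mark.tail ∧ new a n b
    | .int _, _, _, .int _ => False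
  finite_inputs := (G.finite_inputs.image _).union ((G.finite_outputs.inter_of_right _).image _)
  finite_outputs := G.finite_outputs.image _
  disjoint := by
    rw [Set.disjoint_left]
    rintro _ (⟨a, ha, rfl⟩ | ⟨a, ha, rfl⟩) ⟨b, hb, hab⟩
    · cases hab
      exact Set.disjoint_left.1 G.disjoint ha hb
    · cases hab
  edge_symm := by
    rintro (a | a) m n (b | b) h
    · exact G.edge_symm h
    · exact h
    · exact h
    · exact h
  edge_ne := by
    rintro (a | a) m n (b | b) h hab
    · cases hab
      exact G.edge_ne h rfl
    · cases hab
    · cases hab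
    · exact h
  edge_mem := by
    rintro (a | a) m n (b | b) h
    · rcases G.edge_mem h with ha | ha
      · exact Or.inl (Or.inl ⟨a, ha, rfl⟩)
      · exact Or.inr ⟨a, ha, rfl⟩
    · exact Or.inr ⟨a, hnew _ _ _ h.2.2, rfl⟩
    · exact Or.inl (Or.inr ⟨a, h.1, rfl⟩)
    · exact h.elim

/-- Turns the output nodes in `X` into input nodes and deletes the edges in `del`. -/
def fixNodes (G : MixedGraph α) (X : Set α) (del : α → Mark → Mark → α → Prop) :
    MixedGraph α where
  inputs := G.inputs ∪ (X ∩ G.outputs)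
  outputs := G.outputs \ X
  edge a m n b := G.edge a m n b ∧ ¬ del a m n b ∧ ¬ del b n m a
  finite_inputs := G.finite_inputs.union (G.finite_outputs.inter_of_right _)
  finite_outputs := G.finite_outputs.sdiff
  disjoint := by
    rw [Set.disjoint_left]
    rintro a (ha | ha) hb
    · exact Set.disjoint_left.1 G.disjoint ha hb.1
    · exact hb.2 ha.1
  edge_symm := fun h => ⟨G.edge_symm h.1, h.2.2, h.2.1⟩
  edge_ne := fun h => G.edge_ne h.1
  edge_mem := by
    intro a m n b h
    rcases G.edge_mem h.1 with ha | ha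
    · exact Or.inl (Or.inl ha)
    · by_cases hX : a ∈ X
      · exact Or.inl (Or.inr ⟨hX, ha⟩)
      · exact Or.inr ⟨ha, hX⟩

/-! ### Manipulation of iADMGs -/

/-- Soft manipulation of an iADMG: add `I_a → a` for all output nodes `a ∈ X`. -/
def softADMG (G : MixedGraph α) (X : Set α) : MixedGraph (Node α) :=
  G.addInt X (fun a n b => b ∈ G.outputs ∧ b = a ∧ n = Mark.arrow) (fun _ _ _ h => h.1)

/-- Hard manipulation of an iADMG: nodes in `X` become input nodes, and the edges `b ⋆→ a` with
`a ∈ X` are deleted. -/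
def hardADMG (G : MixedGraph α) (X : Set α) : MixedGraph α :=
  G.fixNodes X (fun _ _ n a => a ∈ X ∧ n = Mark.arrow)

/-- First the soft manipulation of `D`, then the hard manipulation of `T`, of an iADMG. -/
def doADMG (G : MixedGraph α) (D T : Set α) : MixedGraph (Node α) :=
  (G.softADMG D).hardADMG (Node.base '' T)

/-! ### Manipulation of iMAGs -/

/-- The edges that a soft manipulation of an iMAG puts between `I_a` and `b` (with a tail at
`I_a` and the mark `n` at `b`). -/
def SoftEdge (G : MixedGraph α) (a : α) (n : Mark) (b : α) : Prop :=
  b ∈ G.outputs ∧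
    ((b = a ∧ n = Mark.arrow ∧ ∃ c, G.ArrowAt a c) ∨
     (b = a ∧ n = Mark.tail ∧ ∃ c, G.Undirected a c) ∨
     (b = a ∧ n = Mark.circle ∧ ¬ ∃ c, G.ArrowAt a c ∨ G.Undirected a c) ∨
     (n = Mark.arrow ∧ G.Directed a b ∧ ¬ G.Visible a b) ∨
     (n = Mark.tail ∧ G.Undirected a b))

/-- Soft manipulation of an iMAG. -/
def softMAG (G : MixedGraph α) (X : Set α) : MixedGraph (Node α) :=
  G.addInt X G.SoftEdge (fun _ _ _ h => h.1)

/-- Hard manipulation of an iMAG (possibly after a soft one): nodes in `X` become input nodes; the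
edges `b ⋆→ a` with `a ∈ X` not an input node, and all edges between nodes in `X ∪ inputs`, are
deleted. -/
def hardMAG (G : MixedGraph α) (X : Set α) : MixedGraph α :=
  G.fixNodes X (fun b _ n a =>
    (a ∈ X \ G.inputs ∧ n = Mark.arrow) ∨ (a ∈ X ∪ G.inputs ∧ b ∈ X ∪ G.inputs))

/-- First the soft manipulation of `D`, then the hard manipulation of `T`, of an iMAG. -/
def doMAG (G : MixedGraph α) (D T : Set α) : MixedGraph (Node α) :=
  (G.softMAG D).hardMAG (Node.base '' T)

/-! ### Separation in manipulated graphs -/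

/-- The triple `u, v, w` of consecutive nodes on a walk in the manipulated graph `H` of `G`, with
mark `m` at `v` on the edge from `u` and mark `m'` at `v` on the edge to `w`, is of one of the forms
that are allowed on an `id`-open walk given `C`. -/
def IdOpenTriple (G : MixedGraph α) (H : MixedGraph (Node α)) (C : Set (Node α))
    (u : Node α) (m : Mark) (v : Node α) (m' : Mark) (w : Node α) : Prop :=
  (m = Mark.tail ∧ v ∉ C) ∨
  (m' = Mark.tail ∧ v ∉ C) ∨
  (m = Mark.circle ∧ m' = Mark.circle ∧ v ∉ C ∧ u ≠ w ∧ ¬ H.Adj u w) ∨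
  (m = Mark.arrow ∧ m' = Mark.arrow ∧ v ∈ H.Anc C ∧
    (¬ u.IsInt ∧ ¬ v.IsInt ∧ ¬ w.IsInt)) ∨
  (m = Mark.arrow ∧ m' = Mark.arrow ∧ v ∈ H.PoAn (C ∩ Node.base '' G.outputs) ∧
    ¬ (¬ u.IsInt ∧ ¬ v.IsInt ∧ ¬ w.IsInt)) ∨
  (m = Mark.circle ∧ m' = Mark.arrow ∧ v ∈ H.PoAn (C ∩ Node.base '' G.outputs) ∧ u.IsInt) ∨
  (m = Mark.arrow ∧ m' = Mark.circle ∧ v ∈ H.PoAn (C ∩ Node.base '' G.outputs) ∧ w.IsInt)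

/-- A walk in the manipulated graph `H` of `G` is `id`-open given `C`. -/
def IdOpen (G : MixedGraph α) {H : MixedGraph (Node α)} (C : Set (Node α)) (π : H.Walk) : Prop :=
  π.node 0 ∉ C ∧ π.node π.length ∉ C ∧
    ∀ i, i + 1 < π.length →
      G.IdOpenTriple H C (π.node i) (π.snd i) (π.node (i + 1)) (π.fst (i + 1)) (π.node (i + 2))

/-- `A` is `id`-separated from `B` given `C` in the graph `H`, obtained from `G` by the soft
manipulation of `D` and the hard manipulation of `T`: every walk in `H` from `A` to
`B ∪ inputs ∪ {I_d | d ∈ D} ∪ T` is blocked. -/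
def IdSep (G : MixedGraph α) (D T : Set α) (H : MixedGraph (Node α))
    (A B C : Set (Node α)) : Prop :=
  ∀ π : H.Walk, π.node 0 ∈ A →
    π.node π.length ∈ B ∪ Node.base '' G.inputs ∪ Node.int '' D ∪ Node.base '' T →
    ¬ G.IdOpen C π

end MixedGraph

/-!
Separation in the manipulated iMAG is compared with separation in the manipulated representatives
one open walk at a time.  Input nodes carry only tails, so that an open walk can be truncated at its
first input node; this gives the normal form `OpenTo` of open walks, in which only the last node may
be an input node.  Nodes of `T` carry only tails and are conditioned on, so no open walk meets them.

*From a representative to the iMAG* (`Represents.openTo_doMAG`).  An open walk of the manipulated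
representative is a chain of inducing walks (`Link`), at first single edges.  If two links meet in a
collider that is an ancestor of a neighbour on the chain or of a selection node, they combine to one
link, or cancel if both neighbours agree.  A chain that admits no such step
(`Link.exists_reduced_chain`) contains no selection nodes, and its colliders are not ancestors of
their neighbours.  Hence it is an open walk of the manipulated iMAG, where a mark between original
nodes is a tail iff the node is an ancestor of its neighbour or of a selection node.  A link between
`I_d` and `u ≠ d` contains an inducing walk between `u` and `d` with an arrowhead at `d`, which
cannot exist if `d → u` is visible (`Represents.not_visible`); thus the manipulated iMAG has the
required edge between `I_d` and `u`.

*From the iMAG to a representative* (`exists_openTo_canon`).  The canonical representative replaces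
each undirected edge `a — b` by `a → s ← b` with a new selection node `s`.  It carries over the open
walk unless the last edge joins `I_d` to some `u ≠ d`.  In this case `d — u`, or `d → u` is
invisible, and an edge `d ↔ u` is added, so that the walk can pass `u ↔ d ← I_d` if `d` is
conditioned on, and `u ← d ← I_d` otherwise when `d → u`.  The additional edge does not change the
represented iMAG (`canon_adj`): an inducing path through `d ↔ u` can be redirected to enter `u`
from a node before `d`, because every node that reaches `d` by a collider path of parents of `u` is
adjacent to `u` (`IsIMAG.redirect_colliderWalk`).
-/

namespace MixedGraph

variable {α β : Type*}

/-! ### Collider walks -/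

/-- `G.ColliderWalk P a m n b`: there is a walk of positive length from `a` to `b` whose first mark,
at `a`, is `m` and whose last mark, at `b`, is `n`, and all of whose non-endnodes are colliders
satisfying `P`. -/
inductive ColliderWalk (G : MixedGraph β) (P : β → Prop) : β → Mark → Mark → β → Prop
  | edge {a m n b} : G.edge a m n b → ColliderWalk G P a m n b
  | cons {a m v n b} : G.edge a m Mark.arrow v → P v → ColliderWalk G P v Mark.arrow n b →
      ColliderWalk G P a m n b

namespace ColliderWalk

variable {G : MixedGraph β} {P Q : β → Prop} {a b v : β} {m n : Mark}

theorem trans (h : G.ColliderWalk P a m Mark.arrow v) (hv : P v)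
    (h' : G.ColliderWalk P v Mark.arrow n b) : G.ColliderWalk P a m n b := by
  generalize hk : Mark.arrow = k at h
  induction h with
  | edge e => subst hk; exact cons e hv h'
  | cons e hP _ ih => exact cons e hP (ih hv h' hk)

theorem symm (h : G.ColliderWalk P a m n b) : G.ColliderWalk P b n m a := by
  induction h with
  | edge e => exact edge (G.edge_symm e)
  | cons e hP _ ih => exact trans ih hP (edge (G.edge_symm e))

theorem mono (h : G.ColliderWalk P a m n b) (hPQ : ∀ v c, G.ArrowAt v c → P v → Q v) :
    G.ColliderWalk Q a m n b := by
  induction h with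
  | edge e => exact edge e
  | cons e hP _ ih =>
    exact cons e (hPQ _ _ ⟨_, G.edge_symm e⟩ hP) ih

theorem exists_edge_left (h : G.ColliderWalk P a m n b) : ∃ k v, G.edge a m k v := by
  cases h with
  | edge e => exact ⟨_, _, e⟩
  | cons e _ _ => exact ⟨_, _, e⟩

/-- Loops can be cut out of a collider walk, and this changes the marks at its endnodes at most into
arrowheads, since a cut at an endnode exposes an arrowhead of a collider. -/
theorem exists_path (h : G.ColliderWalk P a m n b) (hab : a ≠ b) :
    ∃ π : G.Walk, π.IsPath ∧ π.FromTo a b ∧ 1 ≤ π.length ∧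
      (∀ i, i + 1 < π.length → π.ColliderAt i ∧ P (π.node (i + 1))) ∧
      (π.fst 0 = m ∨ π.fst 0 = Mark.arrow) ∧
      (π.snd (π.length - 1) = n ∨ π.snd (π.length - 1) = Mark.arrow) := by
  induction h with
  | @edge a m n b e =>
    refine ⟨⟨1, fun i => if i = 0 then a else b, fun _ => m, fun _ => n, ?_, ?_⟩, ?_, ?_, ?_⟩
    · exact G.edge_mem e
    · intro i hi
      obtain rfl : i = 0 := by omega
      simpa using e
    · intro i hi j hj hij
      simp only at hi hj hij
      by_contra hne
      rcases Nat.le_one_iff_eq_zero_or_eq_one.1 hi with rfl | rfl <;>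
        rcases Nat.le_one_iff_eq_zero_or_eq_one.1 hj with rfl | rfl <;>
        simp_all [eq_comm]
    · simp [Walk.FromTo]
    · simp
  | @cons a m v n b e hP hw ih =>
    by_cases hvb : v = b
    · subst hvb
      refine ⟨⟨1, fun i => if i = 0 then a else v, fun _ => m, fun _ => Mark.arrow, ?_, ?_⟩,
        ?_, ?_, ?_⟩
      · exact G.edge_mem e
      · intro i hi
        obtain rfl : i = 0 := by omega
        simpa using e
      · intro i hi j hj hij
        simp only at hi hj hij
        by_contra hne
        rcases Nat.le_one_iff_eq_zero_or_eq_one.1 hi with rfl | rfl <;>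
          rcases Nat.le_one_iff_eq_zero_or_eq_one.1 hj with rfl | rfl <;>
          simp_all [eq_comm]
      · simp [Walk.FromTo]
      · simp
    obtain ⟨π, hpath, hft, hlen, hcol, hfst, hlast⟩ := ih hvb
    have hfst' : π.fst 0 = Mark.arrow := hfst.elim id id
    by_cases hmem : ∃ j ≤ π.length, π.node j = a
    · obtain ⟨j, hj, hja⟩ := hmem
      have hjl : j ≠ π.length := by
        rintro rfl
        exact hab (hja.symm.trans hft.2)
      have hjs : π.fst j = Mark.arrow := by
        rcases j with _ | j
        · exact hfst'
        · exact (hcol j (by omega)).1.2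
      refine ⟨⟨π.length - j, fun i => π.node (j + i), fun i => π.fst (j + i),
        fun i => π.snd (j + i), ?_, ?_⟩, ?_, ?_, ?_, ?_, ?_, ?_⟩
      · have := π.edge j (by omega)
        exact G.edge_mem this
      · intro i hi
        exact π.edge (j + i) (by omega)
      · intro i hi k hk hik
        simp only at hi hk hik
        have := hpath _ (by omega) _ (by omega) hik
        omega
      · refine ⟨by simpa using hja, ?_⟩
        have : j + (π.length - j) = π.length := by omega
        simpa [this] using hft.2
      · simp only; omega
      · intro i hi
        exact hcol (j + i) (by simp only at hi; omega)
      · exact Or.inr (by simpa using hjs)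
      · have : j + (π.length - j - 1) = π.length - 1 := by omega
        simpa [this] using hlast
    · push Not at hmem
      refine ⟨⟨π.length + 1, fun i => Nat.casesOn i a fun k => π.node k,
        fun i => Nat.casesOn i m fun k => π.fst k,
        fun i => Nat.casesOn i Mark.arrow fun k => π.snd k, ?_, ?_⟩, ?_, ?_, ?_, ?_, ?_, ?_⟩
      · exact G.edge_mem e
      · rintro (_ | i) hi
        · simpa [hft.1] using e
        · exact π.edge i (by omega)
      · rintro (_ | i) hi (_ | j) hj hij
        · rfl
        · exact absurd hij.symm (hmem j (by simp only at hj; omega))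
        · exact absurd hij (hmem i (by simp only at hi; omega))
        · rw [hpath i (by simp only at hi; omega) j (by simp only at hj; omega) hij]
      · exact ⟨rfl, hft.2⟩
      · simp
      · rintro (_ | i) hi
        · exact ⟨⟨rfl, hfst'⟩, by simpa [hft.1] using hP⟩
        · exact hcol i (by simp only at hi; omega)
      · exact Or.inl rfl
      · obtain ⟨k, hk⟩ := Nat.exists_eq_add_of_le' hlen
        simpa [hk] using hlast

theorem hasInducingPath {S : Set β} (h : G.ColliderWalk (· ∈ G.Anc ({a, b} ∪ S)) a m n b)
    (hab : a ≠ b) : G.HasInducingPath S a b := by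
  obtain ⟨π, h1, h2, -, h3, -⟩ := h.exists_path hab
  exact ⟨π, h1, h2, h3⟩

end ColliderWalk

/-- A segment of a sequence of edges along which all inner nodes are colliders satisfying `P`. -/
theorem colliderWalk_of_segment {G : MixedGraph β} {P : β → Prop} (node : ℕ → β)
    (fst snd : ℕ → Mark) (i k : ℕ)
    (hedge : ∀ j, i ≤ j → j ≤ i + k → G.edge (node j) (fst j) (snd j) (node (j + 1)))
    (hcol : ∀ j, i ≤ j → j < i + k →
      snd j = Mark.arrow ∧ fst (j + 1) = Mark.arrow ∧ P (node (j + 1))) :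
    G.ColliderWalk P (node i) (fst i) (snd (i + k)) (node (i + k + 1)) := by
  induction k generalizing i with
  | zero => exact .edge (hedge i le_rfl le_rfl)
  | succ k ih =>
    have h1 := hcol i le_rfl (by omega)
    have e := hedge i le_rfl (by omega)
    have w := ih (i + 1) (fun j _ _ => hedge j (by omega) (by omega))
      (fun j _ _ => hcol j (by omega) (by omega))
    rw [h1.1] at e
    rw [h1.2.1] at w
    have : i + (k + 1) = i + 1 + k := by omega
    rw [this]
    exact .cons e h1.2.2 w

theorem HasInducingPath.exists_colliderWalk {G : MixedGraph β} {S : Set β} {a b : β}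
    (h : G.HasInducingPath S a b) (hab : a ≠ b) :
    ∃ m n, G.ColliderWalk (· ∈ G.Anc ({a, b} ∪ S)) a m n b := by
  obtain ⟨π, -, hft, hcol⟩ := h
  have hlen : π.length ≠ 0 := by
    intro h0
    exact hab (hft.1.symm.trans (by rw [← hft.2, h0]))
  obtain ⟨k, hk⟩ := Nat.exists_eq_succ_of_ne_zero hlen
  have := colliderWalk_of_segment (G := G) (P := (· ∈ G.Anc ({a, b} ∪ S))) π.node π.fst π.snd 0 k
    (fun j _ _ => π.edge j (by omega))
    (fun j _ _ => ⟨(hcol j (by omega)).1.1, (hcol j (by omega)).1.2, (hcol j (by omega)).2⟩)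
  have e1 : 0 + k + 1 = π.length := by omega
  rw [e1, hft.1, hft.2] at this
  exact ⟨_, _, this⟩

/-! ### A normal form of open walks -/

/-- On an open walk given `Z` the node `v` may occur between edges with the marks `n` and `m` at
`v`: as a noncollider with a tail outside `Z`, or as a collider that is an ancestor of `Z ∩ O`. -/
def OpenAt (H : MixedGraph β) (Z O : Set β) (v : β) (n m : Mark) : Prop :=
  (n = Mark.tail ∨ m = Mark.tail) ∧ v ∉ Z ∨
    n = Mark.arrow ∧ m = Mark.arrow ∧ v ∈ H.Anc (Z ∩ O)

/-- `H.OpenTo Z O b a m`: there is a walk of positive length from `a` to `b` with the mark `m` at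
`a`, such that all its non-endnodes satisfy `OpenAt` and no node before the last one is an input
node. -/
inductive OpenTo (H : MixedGraph β) (Z O : Set β) (b : β) : β → Mark → Prop
  | edge {a m n} : a ∉ H.inputs → H.edge a m n b → OpenTo H Z O b a m
  | cons {a m n v m'} : a ∉ H.inputs → H.edge a m n v → H.OpenAt Z O v n m' →
      OpenTo H Z O b v m' → OpenTo H Z O b a m

theorem OpenTo.exists_walk {H : MixedGraph β} {Z O : Set β} {a b : β} {m : Mark}
    (h : H.OpenTo Z O b a m) :
    ∃ π : H.Walk, π.FromTo a b ∧ π.fst 0 = m ∧ 1 ≤ π.length ∧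
      ∀ i, i + 1 < π.length → H.OpenAt Z O (π.node (i + 1)) (π.snd i) (π.fst (i + 1)) := by
  induction h with
  | @edge a m n _ e =>
    refine ⟨⟨1, fun i => if i = 0 then a else b, fun _ => m, fun _ => n, ?_, ?_⟩, ?_, ?_, ?_⟩
    · exact H.edge_mem e
    · intro i hi
      obtain rfl : i = 0 := by omega
      simpa using e
    · simp [Walk.FromTo]
    · rfl
    · simp
  | @cons a m n v m' _ e hv _ ih =>
    obtain ⟨π, hft, hfst, hlen, hop⟩ := ih
    refine ⟨⟨π.length + 1, fun i => Nat.casesOn i a fun k => π.node k,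
      fun i => Nat.casesOn i m fun k => π.fst k,
      fun i => Nat.casesOn i n fun k => π.snd k, ?_, ?_⟩, ?_, ?_, ?_, ?_⟩
    · exact H.edge_mem e
    · rintro (_ | i) hi
      · simpa [hft.1] using e
      · exact π.edge i (by omega)
    · exact ⟨rfl, hft.2⟩
    · rfl
    · simp
    · rintro (_ | i) hi
      · simpa [hft.1, hfst] using hv
      · exact hop i (by simp only at hi; omega)

/-- What the manipulated graphs have in common: input nodes carry only tails; circles occur only on
edges to input nodes, a node carries circles towards at most one neighbour, and a node with a circle
carries no arrowheads. -/
structure Tame (H : MixedGraph β) : Prop where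
  tail_of_input : ∀ {a m n b}, H.edge a m n b → a ∈ H.inputs → m = Mark.tail
  input_of_circle : ∀ {a n b}, H.edge a Mark.circle n b → b ∈ H.inputs
  circle_unique : ∀ {a n b n' b'}, H.edge a Mark.circle n b → H.edge a Mark.circle n' b' → b = b'
  not_arrow_of_circle : ∀ {a n b n' b'}, H.edge a Mark.circle n b → ¬ H.edge a Mark.arrow n' b'

namespace Tame

variable {H : MixedGraph β}

theorem not_mem_inputs_of_directed (hH : H.Tame) {a b : β} (h : H.Directed a b) :
    b ∉ H.inputs := fun hb => by
  have := hH.tail_of_input (H.edge_symm h) hb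
  cases this

theorem not_mem_inputs_of_reflTransGen (hH : H.Tame) {a b : β} (ha : a ∉ H.inputs)
    (h : Relation.ReflTransGen H.Directed a b) : b ∉ H.inputs := by
  rcases h.cases_tail with rfl | ⟨c, -, hc⟩
  · exact ha
  · exact hH.not_mem_inputs_of_directed hc

theorem directed_of_poDirected (hH : H.Tame) {a b : β} (ha : a ∉ H.inputs)
    (h : H.PoDirected a b) : H.Directed a b := by
  obtain ⟨m, n, e, hm, hn⟩ := h
  cases m with
  | arrow => exact absurd rfl hm
  | circle => exact absurd (hH.tail_of_input (H.edge_symm e) (hH.input_of_circle e)) hn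
  | tail =>
    cases n with
    | tail => exact absurd rfl hn
    | circle => exact absurd (hH.input_of_circle (H.edge_symm e)) ha
    | arrow => exact e

theorem reflTransGen_directed_of_poDirected (hH : H.Tame) {a b : β} (ha : a ∉ H.inputs)
    (h : Relation.ReflTransGen H.PoDirected a b) : Relation.ReflTransGen H.Directed a b := by
  induction h using Relation.ReflTransGen.head_induction_on with
  | refl => exact .refl
  | head e _ ih =>
    have e' := hH.directed_of_poDirected ha e
    exact .head e' (ih (hH.not_mem_inputs_of_directed e'))

end Tame

section NormalForm

variable {G : MixedGraph α} {H : MixedGraph (Node α)} {C : Set (Node α)}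

theorem IdOpenTriple.openAt (hH : H.Tame) (hout : H.outputs ⊆ Node.base '' G.outputs)
    {u v w : Node α} {k m m' k' : Mark} (h : G.IdOpenTriple H C u m v m' w)
    (e : H.edge u k m v) (e' : H.edge v m' k' w) (hv : v ∉ H.inputs) :
    H.OpenAt C (Node.base '' G.outputs) v m m' := by
  have key : ∀ x ∈ C, Relation.ReflTransGen H.Directed v x →
      v ∈ H.Anc (C ∩ Node.base '' G.outputs) := by
    intro x hx hvx
    refine ⟨x, ⟨hx, hout ?_⟩, hvx⟩
    have hx' := hH.not_mem_inputs_of_reflTransGen hv hvx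
    rcases hvx.cases_tail with rfl | ⟨c, -, hc⟩
    · exact (H.edge_mem e').resolve_left hx'
    · exact (H.edge_mem (H.edge_symm hc)).resolve_left hx'
  have key' : v ∈ H.PoAn (C ∩ Node.base '' G.outputs) →
      v ∈ H.Anc (C ∩ Node.base '' G.outputs) := by
    rintro ⟨x, hx, hvx⟩
    exact ⟨x, hx, hH.reflTransGen_directed_of_poDirected hv hvx⟩
  rcases h with h | h | ⟨rfl, rfl, -, hne, -⟩ | ⟨hm, hm', ⟨x, hx, hvx⟩, -⟩ | ⟨hm, hm', hx, -⟩ |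
    ⟨rfl, rfl, -⟩ | ⟨rfl, rfl, -⟩
  · exact Or.inl ⟨Or.inl h.1, h.2⟩
  · exact Or.inl ⟨Or.inr h.1, h.2⟩
  · exact absurd (hH.circle_unique (H.edge_symm e) e') hne
  · exact Or.inr ⟨hm, hm', key x hx hvx⟩
  · exact Or.inr ⟨hm, hm', key' hx⟩
  · exact absurd e' (hH.not_arrow_of_circle (H.edge_symm e))
  · exact absurd (H.edge_symm e) (hH.not_arrow_of_circle e')

theorem OpenAt.idOpenTriple {u v w : Node α} {m m' : Mark}
    (h : H.OpenAt C (Node.base '' G.outputs) v m m') : G.IdOpenTriple H C u m v m' w := by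
  rcases h with ⟨h | h, hv⟩ | ⟨hm, hm', x, hx, hvx⟩
  · exact Or.inl ⟨h, hv⟩
  · exact Or.inr (Or.inl ⟨h, hv⟩)
  · by_cases hi : ¬ u.IsInt ∧ ¬ v.IsInt ∧ ¬ w.IsInt
    · exact Or.inr (Or.inr (Or.inr (Or.inl ⟨hm, hm', ⟨x, hx.1, hvx⟩, hi⟩)))
    · exact Or.inr (Or.inr (Or.inr (Or.inr (Or.inl ⟨hm, hm',
        ⟨x, hx, hvx.lift id fun a b hab => ⟨_, _, hab, by simp, by simp⟩⟩, hi⟩))))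

/-- An input node on an open walk is not in `C`, so that the walk can be truncated there. -/
theorem IdOpenTriple.not_mem_of_input (hH : H.Tame) {u v w : Node α} {k m m' : Mark}
    (h : G.IdOpenTriple H C u m v m' w) (e : H.edge u k m v) (hv : v ∈ H.inputs) : v ∉ C := by
  have h1 := hH.tail_of_input (H.edge_symm e) hv
  subst h1
  simp only [IdOpenTriple, true_and, reduceCtorEq, false_and, or_false] at h
  exact h.elim id And.right

theorem exists_openTo_of_not_idSep (hH : H.Tame) (hout : H.outputs ⊆ Node.base '' G.outputs)
    {D T : Set α}
    (hin : H.inputs ⊆ Node.base '' G.inputs ∪ Node.int '' D ∪ Node.base '' T)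
    {A B : Set (Node α)}
    (hA : ∀ a ∈ A, a ∉ B ∪ Node.base '' G.inputs ∪ Node.int '' D ∪ Node.base '' T)
    (h : ¬ G.IdSep D T H A B C) :
    ∃ a ∈ A, ∃ b ∈ B ∪ Node.base '' G.inputs ∪ Node.int '' D ∪ Node.base '' T, a ∉ C ∧ b ∉ C ∧
      ∃ m, H.OpenTo C (Node.base '' G.outputs) b a m := by
  classical
  have hin' : H.inputs ⊆ B ∪ Node.base '' G.inputs ∪ Node.int '' D ∪ Node.base '' T := by
    intro x hx
    rcases hin hx with (h | h) | h
    · exact Or.inl (Or.inl (Or.inr h))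
    · exact Or.inl (Or.inr h)
    · exact Or.inr h
  simp only [IdSep, not_forall, not_not] at h
  obtain ⟨π, h0, hl, hopen⟩ := h
  have hlen : 1 ≤ π.length := by
    rw [Nat.one_le_iff_ne_zero]
    intro h00
    exact hA _ h0 (by rw [← h00]; rwa [h00] at hl ⊢)
  have hex : ∃ k, 1 ≤ k ∧ (k = π.length ∨ π.node k ∈ H.inputs) := ⟨_, hlen, Or.inl rfl⟩
  obtain ⟨hk1, hk⟩ := Nat.find_spec hex
  set k := Nat.find hex with hkdef
  have hkl : k ≤ π.length := Nat.find_min' hex ⟨hlen, Or.inl rfl⟩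
  have hmin : ∀ j < k, π.node j ∉ H.inputs := by
    intro j hj hjin
    rcases Nat.eq_zero_or_pos j with rfl | hj0
    · exact hA _ h0 (hin' hjin)
    · exact Nat.find_min hex hj ⟨hj0, Or.inr hjin⟩
  have hopenTo : ∀ d j, j + d + 1 = k →
      H.OpenTo C (Node.base '' G.outputs) (π.node k) (π.node j) (π.fst j) := by
    intro d
    induction d with
    | zero =>
      intro j hj
      have e := π.edge j (by omega)
      rw [show j + 1 = k by omega] at e
      exact .edge (hmin j (by omega)) e
    | succ d ih =>
      intro j hj
      have e := π.edge j (by omega)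
      exact .cons (hmin j (by omega)) e ((hopen.2.2 j (by omega)).openAt hH hout e
        (π.edge (j + 1) (by omega)) (hmin _ (by omega))) (ih (j + 1) (by omega))
  refine ⟨_, h0, π.node k, ?_, hopen.1, ?_, _, hopenTo (k - 1) 0 (by omega)⟩
  · rcases hk with hk | hk
    · rwa [hk]
    · exact hin' hk
  · by_cases hkl' : k = π.length
    · rw [hkl']; exact hopen.2.1
    · obtain ⟨j, hj⟩ := Nat.exists_eq_add_of_le' hk1
      have ho := hopen.2.2 j (by omega)
      have e := π.edge j (by omega)
      rw [hj]
      exact ho.not_mem_of_input hH e (by rw [← hj]; exact hk.resolve_left hkl')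

theorem not_idSep_of_openTo {D T : Set α} {A B : Set (Node α)} {a b : Node α} {m : Mark}
    (ha : a ∈ A) (hb : b ∈ B ∪ Node.base '' G.inputs ∪ Node.int '' D ∪ Node.base '' T)
    (haC : a ∉ C) (hbC : b ∉ C) (h : H.OpenTo C (Node.base '' G.outputs) b a m) :
    ¬ G.IdSep D T H A B C := by
  intro hsep
  obtain ⟨π, hft, -, -, hop⟩ := h.exists_walk
  refine hsep π (by rw [hft.1]; exact ha) (by rw [hft.2]; exact hb)
    ⟨by rwa [hft.1], by rwa [hft.2], fun i hi => (hop i hi).idOpenTriple⟩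

end NormalForm

/-! ### Chains of inducing links and their reduction -/

/-- `a` is an ancestor of `b` or of `S`. -/
def AncTo (G : MixedGraph β) (S : Set β) (a b : β) : Prop := a ∈ G.Anc ({b} ∪ S)

section AncTo

variable {G : MixedGraph β} {S : Set β} {a b c : β}

theorem ancTo_iff : G.AncTo S a b ↔ Relation.ReflTransGen G.Directed a b ∨ a ∈ G.Anc S := by
  constructor
  · rintro ⟨x, rfl | hx, h⟩
    · exact Or.inl h
    · exact Or.inr ⟨x, hx, h⟩
  · rintro (h | ⟨x, hx, h⟩)
    · exact ⟨b, Or.inl rfl, h⟩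
    · exact ⟨x, Or.inr hx, h⟩

theorem anc_trans {X : Set β} (h : Relation.ReflTransGen G.Directed a b) (hb : b ∈ G.Anc X) :
    a ∈ G.Anc X := by
  obtain ⟨x, hx, hbx⟩ := hb
  exact ⟨x, hx, h.trans hbx⟩

theorem AncTo.trans (h : G.AncTo S a b) (h' : G.AncTo S b c) : G.AncTo S a c := by
  rcases ancTo_iff.1 h with h1 | h1
  · exact anc_trans h1 h'
  · exact ancTo_iff.2 (Or.inr h1)

theorem AncTo.of_anc (h : a ∈ G.Anc S) : G.AncTo S a b := ancTo_iff.2 (Or.inr h)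

theorem AncTo.of_directed (h : G.Directed a b) : G.AncTo S a b := ancTo_iff.2 (Or.inl (.single h))

/-- In an acyclic graph, distinct nodes that are ancestors of each other or of `S` are ancestors of
`S`. -/
theorem AncTo.anc_of_antisymm (hG : ∀ a, ¬ Relation.TransGen G.Directed a a)
    (h : G.AncTo S a b) (h' : G.AncTo S b a) (hab : a ≠ b) : a ∈ G.Anc S := by
  rcases ancTo_iff.1 h with h1 | h1
  · rcases ancTo_iff.1 h' with h2 | h2
    · rcases Relation.reflTransGen_iff_eq_or_transGen.1 h1 with h3 | h3
      · exact absurd h3.symm hab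
      · exact absurd (h3.trans_left h2) (hG a)
    · exact anc_trans h1 h2
  · exact h1

theorem mem_anc_pair_iff {v : β} :
    v ∈ G.Anc ({a, b} ∪ S) ↔ G.AncTo S v a ∨ G.AncTo S v b := by
  constructor
  · rintro ⟨x, (rfl | rfl) | hx, h⟩
    · exact Or.inl (ancTo_iff.2 (Or.inl h))
    · exact Or.inr (ancTo_iff.2 (Or.inl h))
    · exact Or.inl (AncTo.of_anc ⟨x, hx, h⟩)
  · rintro (⟨x, rfl | hx, h⟩ | ⟨x, rfl | hx, h⟩)
    · exact ⟨_, Or.inl (Or.inl rfl), h⟩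
    · exact ⟨_, Or.inr hx, h⟩
    · exact ⟨_, Or.inl (Or.inr rfl), h⟩
    · exact ⟨_, Or.inr hx, h⟩

end AncTo

/-- An `S`-inducing walk of positive length between the distinct nodes `s` and `t`, with the mark
`m` at `s` and the mark `n` at `t`, where `s` is not in the set `I`. -/
structure Link (G : MixedGraph β) (S I : Set β) where
  s : β
  m : Mark
  n : Mark
  t : β
  ne : s ≠ t
  not_mem : s ∉ I
  walk : G.ColliderWalk (fun v => G.AncTo S v s ∨ G.AncTo S v t) s m n t

namespace Link

variable {G : MixedGraph β} {S I Z K : Set β}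

/-- The links `x` and `y` share a node which either is outside `Z` and an ancestor of a neighbour
or of `S`, or is a collider in `K`. -/
def Joined (Z K : Set β) (x y : Link G S I) : Prop :=
  x.t = y.s ∧ ((y.s ∉ Z ∧ (G.AncTo S y.s x.s ∨ G.AncTo S y.s y.t)) ∨
    (x.n = Mark.arrow ∧ y.m = Mark.arrow ∧ y.s ∈ K))

/-- As `Joined`, but colliders are required not to be ancestors of a neighbour or of `S`. -/
def JoinedReduced (Z K : Set β) (x y : Link G S I) : Prop :=
  x.t = y.s ∧ ((y.s ∉ Z ∧ (G.AncTo S y.s x.s ∨ G.AncTo S y.s y.t)) ∨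
    (x.n = Mark.arrow ∧ y.m = Mark.arrow ∧ y.s ∈ K ∧
      ¬ (G.AncTo S y.s x.s ∨ G.AncTo S y.s y.t)))

/-- Two links that meet in a collider which is an ancestor of a neighbour or of `S` combine to a
link between the neighbours. -/
theorem exists_comp (x y : Link G S I) (hxy : x.t = y.s) (hn : x.n = Mark.arrow)
    (hm : y.m = Mark.arrow) (hA : G.AncTo S y.s x.s ∨ G.AncTo S y.s y.t) (hne : x.s ≠ y.t) :
    ∃ z : Link G S I, z.s = x.s ∧ z.m = x.m ∧ z.n = y.n ∧ z.t = y.t := by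
  obtain ⟨xs, xm, xn, xt, xne, xI, xw⟩ := x
  obtain ⟨ys, ym, yn, yt, yne, yI, yw⟩ := y
  simp only at hxy hn hm hA hne
  subst hxy hn hm
  refine ⟨⟨xs, xm, yn, yt, hne, xI, ?_⟩, rfl, rfl, rfl, rfl⟩
  refine .trans (v := xt) (xw.mono fun v _ _ hv => ?_) hA (yw.mono fun v _ _ hv => ?_)
  · rcases hv with hv | hv
    · exact Or.inl hv
    · exact hA.imp hv.trans hv.trans
  · rcases hv with hv | hv
    · exact hA.imp hv.trans hv.trans
    · exact Or.inr hv

/-- A chain of links can be shortened until no collider is an ancestor of a neighbour or of `S`.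
Removing such a collider keeps its neighbours in order: a neighbour which is an ancestor of the
removed node is an ancestor of the next node or of `S`. -/
theorem exists_reduced_chain (hG : ∀ a, ¬ Relation.TransGen G.Directed a a) {a b : β}
    (hab : a ≠ b) (l : List (Link G S I)) (hl : l ≠ []) (ha : ∀ x ∈ l.head?, x.s = a)
    (hb : ∀ x ∈ l.getLast?, x.t = b) (hc : l.IsChain (Joined Z K)) :
    ∃ l' : List (Link G S I), l' ≠ [] ∧ (∀ x ∈ l'.head?, x.s = a) ∧
      (∀ x ∈ l'.getLast?, x.t = b) ∧ l'.IsChain (JoinedReduced Z K) := by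
  induction hk : l.length using Nat.strong_induction_on generalizing l with
  | _ k ih =>
  by_cases hred : l.IsChain (JoinedReduced Z K)
  · exact ⟨l, hl, ha, hb, hred⟩
  rw [List.isChain_iff_forall_rel_of_append_cons_cons] at hred
  push Not at hred
  obtain ⟨x, y, l₁, l₂, rfl, hxy⟩ := hred
  rw [List.isChain_append] at hc
  obtain ⟨hc1, hc2, hc3⟩ := hc
  rw [List.isChain_cons_cons, List.isChain_cons] at hc2
  obtain ⟨hJ, hc4, hc5⟩ := hc2
  have hc6 : ∀ w ∈ l₁.getLast?, Joined Z K w x := fun w hw => hc3 w hw x (by simp)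
  clear hc3
  obtain ⟨ht, hN | ⟨hn, hm, hK⟩⟩ := hJ
  · exact absurd ⟨ht, Or.inl hN⟩ hxy
  have hA : G.AncTo S y.s x.s ∨ G.AncTo S y.s y.t := by
    by_contra hA
    exact hxy ⟨ht, Or.inr ⟨hn, hm, hK, hA⟩⟩
  by_cases hne : x.s = y.t
  · -- the walk returns to the node before the collider, so both links are dropped
    have hA' : G.AncTo S y.s x.s := by simpa [hne] using hA
    have hback : G.AncTo S x.s y.s → x.s ∈ G.Anc S := fun h =>
      h.anc_of_antisymm hG hA' (by rw [← ht]; exact x.ne)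
    have hjoin : ∀ w ∈ l₁.getLast?, ∀ u ∈ l₂.head?, Joined Z K w u := by
      intro w hw u hu
      obtain ⟨h1, h2⟩ := hc6 w hw
      obtain ⟨h3, h4⟩ := hc4 u hu
      have hus : u.s = x.s := by rw [← h3, hne]
      refine ⟨h1.trans hus.symm, ?_⟩
      rw [hus] at h4 ⊢
      rcases h2 with ⟨h2, h2' | h2'⟩ | h2
      · exact Or.inl ⟨h2, Or.inl h2'⟩
      · exact Or.inl ⟨h2, Or.inl (AncTo.of_anc (hback (ht ▸ h2')))⟩
      · rcases h4 with ⟨h4, h4' | h4'⟩ | h4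
        · exact Or.inl ⟨h4, Or.inl (AncTo.of_anc (hback h4'))⟩
        · exact Or.inl ⟨h4, Or.inr h4'⟩
        · exact Or.inr ⟨h2.1, h4.2.1, h4.2.2⟩
    refine ih (l₁ ++ l₂).length ?_ (l₁ ++ l₂) ?_ ?_ ?_ ?_ rfl
    · simp at hk ⊢; omega
    · intro h0
      obtain ⟨rfl, rfl⟩ := List.append_eq_nil_iff.1 h0
      have h1 := ha x (by simp)
      have h2 := hb y (by simp)
      exact hab (by rw [← h1, ← h2, hne])
    · intro w hw
      rcases l₁ with _ | ⟨z, l₁⟩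
      · have h1 := ha x (by simp)
        have h3 := (hc4 w (by simpa using hw)).1
        rw [← h3, ← hne, h1]
      · exact ha w (by simpa using hw)
    · intro w hw
      rcases List.eq_nil_or_concat l₂ with rfl | ⟨l₂, z, rfl⟩
      · have h1 := hb y (by simp)
        have h3 := (hc6 w (by simpa using hw)).1
        rw [h3, hne, h1]
      · refine hb w ?_
        simpa [List.getLast?_append, List.getLast?_cons] using hw
    · rw [List.isChain_append]
      exact ⟨hc1, hc5, hjoin⟩
  · obtain ⟨z, hzs, hzm, hzn, hzt⟩ := exists_comp x y ht hn hm hA hne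
    refine ih (l₁ ++ z :: l₂).length ?_ (l₁ ++ z :: l₂) (by simp) ?_ ?_ ?_ rfl
    · simp at hk ⊢; omega
    · intro w hw
      rcases l₁ with _ | ⟨u, l₁⟩
      · obtain rfl : z = w := by simpa using hw
        rw [hzs]
        exact ha x (by simp)
      · exact ha w (by simpa using hw)
    · intro w hw
      rcases List.eq_nil_or_concat l₂ with rfl | ⟨l₂, u, rfl⟩
      · obtain rfl : z = w := by simpa [List.getLast?_append] using hw
        rw [hzt]
        exact hb y (by simp [List.getLast?_append])
      · refine hb w ?_
        simpa [List.getLast?_append, List.getLast?_cons] using hw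
    · rw [List.isChain_append, List.isChain_cons]
      refine ⟨hc1, ⟨?_, hc5⟩, ?_⟩
      · intro u hu
        obtain ⟨h3, h4⟩ := hc4 u hu
        refine ⟨hzt.trans h3, ?_⟩
        rw [hzs, hzn]
        rcases h4 with ⟨h4, h4' | h4'⟩ | h4
        · refine Or.inl ⟨h4, Or.inl ?_⟩
          rcases hA with hA | hA
          · exact h4'.trans hA
          · rw [h3] at hA
            exact AncTo.of_anc (h4'.anc_of_antisymm hG hA (by rw [← h3]; exact y.ne.symm))
        · exact Or.inl ⟨h4, Or.inr h4'⟩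
        · exact Or.inr h4
      · intro w hw u hu
        obtain rfl : z = u := by simpa using hu
        obtain ⟨h1, h2⟩ := hc6 w hw
        refine ⟨h1.trans hzs.symm, ?_⟩
        rw [hzs, hzm, hzt]
        rcases h2 with ⟨h2, h2' | h2'⟩ | h2
        · exact Or.inl ⟨h2, Or.inl h2'⟩
        · refine Or.inl ⟨h2, Or.inr ?_⟩
          rw [ht] at h2'
          rcases hA with hA | hA
          · exact AncTo.of_anc (h2'.anc_of_antisymm hG hA (by rw [← ht]; exact x.ne))
          · exact h2'.trans hA
        · exact Or.inr h2

end Link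

/-! ### Edges of the manipulated graphs -/

theorem mem_inputs_doADMG {G : MixedGraph α} {D T : Set α} {v : Node α} :
    v ∈ (G.doADMG D T).inputs ↔
      (v ∈ Node.base '' G.inputs ∨ v ∈ Node.int '' (D ∩ G.outputs)) ∨
        (v ∈ Node.base '' T ∧ v ∈ Node.base '' G.outputs) := Iff.rfl

theorem base_mem_image {s : Set α} {a : α} : Node.base a ∈ Node.base '' s ↔ a ∈ s := by
  simp

theorem base_notMem_int_image {s : Set α} {a : α} : Node.base a ∉ Node.int '' s := by
  simp

theorem base_notMem_inputs_doADMG {G : MixedGraph α} {D T : Set α} {a : α} :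
    Node.base a ∉ (G.doADMG D T).inputs ↔ a ∉ G.inputs ∧ (a ∈ T → a ∉ G.outputs) := by
  rw [mem_inputs_doADMG]
  simp only [base_mem_image, base_notMem_int_image, or_false]
  tauto

theorem base_notMem_inputs_doMAG {G : MixedGraph α} {D T : Set α} {a : α} :
    Node.base a ∉ (G.doMAG D T).inputs ↔ a ∉ G.inputs ∧ (a ∈ T → a ∉ G.outputs) :=
  base_notMem_inputs_doADMG

theorem IsIADMG.arrow_of_tail {G : MixedGraph α} (hG : G.IsIADMG) {a b : α} {n : Mark}
    (h : G.edge a Mark.tail n b) : n = Mark.arrow := by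
  rcases hG.edge_type h with h | h | h <;> simp_all

theorem softADMG_edge_int {G : MixedGraph α} {D : Set α} {a d : α} {m n : Mark} :
    (G.softADMG D).edge (.base a) m n (.int d) ↔
      d ∈ D ∩ G.outputs ∧ n = Mark.tail ∧ a ∈ G.outputs ∧ a = d ∧ m = Mark.arrow := Iff.rfl

theorem softADMG_edge_type {G : MixedGraph α} (hG : G.IsIADMG) {D : Set α} {a b : Node α}
    {m n : Mark} (h : (G.softADMG D).edge a m n b) :
    (m = Mark.tail ∧ n = Mark.arrow) ∨ (m = Mark.arrow ∧ n = Mark.tail) ∨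
      (m = Mark.arrow ∧ n = Mark.arrow) := by
  rcases a with a | a <;> rcases b with b | b
  · exact hG.edge_type h
  · obtain ⟨-, rfl, -, -, rfl⟩ := h
    simp
  · obtain ⟨-, rfl, -, -, rfl⟩ := h
    simp
  · exact h.elim

theorem softADMG_directed_of_tail {G : MixedGraph α} (hG : G.IsIADMG) {D : Set α} {a b : Node α}
    {n : Mark} (h : (G.softADMG D).edge a Mark.tail n b) : (G.softADMG D).Directed a b := by
  rcases softADMG_edge_type hG h with ⟨-, rfl⟩ | h' | h'
  · exact h
  · cases h'.1
  · cases h'.1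

theorem tame_doADMG {G : MixedGraph α} (hG : G.IsIADMG) (D T : Set α) : (G.doADMG D T).Tame := by
  have hcirc : ∀ {a n b}, ¬ (G.doADMG D T).edge a Mark.circle n b := fun h => by
    have := softADMG_edge_type hG h.1
    simp at this
  refine ⟨?_, fun h => absurd h hcirc, fun h => absurd h hcirc, fun h => absurd h hcirc⟩
  intro a m n b h ha
  have ht := softADMG_edge_type hG h.1
  have hm : m ≠ Mark.arrow := by
    rintro rfl
    rcases ha with (⟨x, hx, rfl⟩ | ⟨x, hx, rfl⟩) | ⟨hx, -⟩
    · rcases b with b | b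
      · exact hG.no_arrow_input hx ⟨_, h.1⟩
      · exact Set.disjoint_left.1 G.disjoint hx h.1.2.2.1
    · rcases b with b | b
      · exact absurd h.1.2.1 (by simp)
      · exact h.1
    · exact h.2.2 ⟨hx, rfl⟩
  rcases ht with ht | ht | ht
  · exact ht.1
  · exact absurd ht.1 hm
  · exact absurd ht.1 hm

theorem softMAG_edge_base {G : MixedGraph α} {D : Set α} {a b : α} {m n : Mark} :
    (G.softMAG D).edge (.base a) m n (.base b) ↔ G.edge a m n b := Iff.rfl

theorem softMAG_edge_int {G : MixedGraph α} {D : Set α} {a d : α} {m n : Mark} :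
    (G.softMAG D).edge (.base a) m n (.int d) ↔
      d ∈ D ∩ G.outputs ∧ n = Mark.tail ∧ G.SoftEdge d m a := Iff.rfl

theorem doMAG_edge {G : MixedGraph α} {D T : Set α} {a b : Node α} {m n : Mark} :
    (G.doMAG D T).edge a m n b ↔ (G.softMAG D).edge a m n b ∧
      ¬ ((b ∈ Node.base '' T \ (G.softMAG D).inputs ∧ n = Mark.arrow) ∨
        (b ∈ Node.base '' T ∪ (G.softMAG D).inputs ∧ a ∈ Node.base '' T ∪ (G.softMAG D).inputs)) ∧
      ¬ ((a ∈ Node.base '' T \ (G.softMAG D).inputs ∧ m = Mark.arrow) ∨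
        (a ∈ Node.base '' T ∪ (G.softMAG D).inputs ∧ b ∈ Node.base '' T ∪ (G.softMAG D).inputs)) :=
  Iff.rfl

/-- An edge of the softly manipulated graph survives the hard manipulation if one of its ends is
neither an input nor in `T`, and if it has no arrowhead at an element of `T`. -/
theorem doMAG_edge_of {G : MixedGraph α} {D T : Set α} {a : α} {b : Node α} {m n : Mark}
    (h : (G.softMAG D).edge (.base a) m n b) (haI : a ∉ G.inputs) (haT : a ∉ T)
    (hbT : b ∉ Node.base '' T) : (G.doMAG D T).edge (.base a) m n b := by
  have ha : (Node.base a : Node α) ∉ Node.base '' T ∪ (G.softMAG D).inputs := by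
    rintro (h | h | h)
    · exact haT (base_mem_image.1 h)
    · exact haI (base_mem_image.1 h)
    · exact base_notMem_int_image h
  rw [doMAG_edge]
  refine ⟨h, ?_, ?_⟩
  · rintro (⟨h, -⟩ | ⟨-, h⟩)
    · exact hbT h.1
    · exact ha h
  · rintro (⟨h, -⟩ | ⟨h, -⟩)
    · exact ha (Or.inl h.1)
    · exact ha h

theorem SoftEdge.arrowAt {G : MixedGraph α} {d a : α} (h : G.SoftEdge d Mark.arrow a) :
    ∃ c, G.ArrowAt a c := by
  rcases h with ⟨-, ⟨rfl, -, h⟩ | ⟨-, h, -⟩ | ⟨-, h, -⟩ | ⟨-, h, -⟩ | ⟨h, -⟩⟩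
  · exact h
  · cases h
  · cases h
  · exact ⟨d, _, G.edge_symm h⟩
  · cases h

theorem SoftEdge.of_circle {G : MixedGraph α} {d a : α} (h : G.SoftEdge d Mark.circle a) :
    a = d ∧ ¬ ∃ c, G.ArrowAt a c ∨ G.Undirected a c := by
  rcases h with ⟨-, ⟨-, h, -⟩ | ⟨-, h, -⟩ | ⟨rfl, -, h⟩ | ⟨h, -⟩ | ⟨h, -⟩⟩
  · cases h
  · cases h
  · exact ⟨rfl, h⟩
  · cases h
  · cases h

theorem tame_doMAG {M : MixedGraph α} (hM : M.IsIMAG) (D : Set α) {T : Set α}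
    (hT : T ⊆ M.outputs) : (M.doMAG D T).Tame := by
  have hcirc : ∀ {a : Node α} {n b}, (M.softMAG D).edge a Mark.circle n b →
      ∃ d, d ∈ D ∩ M.outputs ∧ a = .base d ∧ b = .int d ∧
        ¬ ∃ c, M.ArrowAt d c ∨ M.Undirected d c := by
    rintro (a | a) n (b | b) h
    · exact absurd rfl (hM.no_circle h).1
    · obtain ⟨hb, -, h⟩ := h
      obtain ⟨rfl, h'⟩ := h.of_circle
      exact ⟨_, hb, rfl, rfl, h'⟩
    · exact absurd h.2.1 (by simp)
    · exact h.elim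
  refine ⟨?_, ?_, ?_, ?_⟩
  · intro a m n b h ha
    rcases ha with (⟨x, hx, rfl⟩ | ⟨x, hx, rfl⟩) | ⟨⟨x, hx, rfl⟩, -⟩
    · rcases b with b | b
      · cases m with
        | tail => rfl
        | arrow => exact absurd ⟨_, h.1⟩ (hM.no_arrow_input hx)
        | circle => exact absurd rfl (hM.no_circle h.1).1
      · exact absurd h.1.2.2.1 (Set.disjoint_left.1 M.disjoint hx)
    · rcases b with b | b
      · exact h.1.2.1
      · exact h.1.elim
    · cases m with
      | tail => rfl
      | arrow =>
        refine absurd (Or.inl ⟨⟨⟨x, hx, rfl⟩, ?_⟩, rfl⟩) h.2.2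
        rintro (h' | h')
        · exact Set.disjoint_left.1 M.disjoint (base_mem_image.1 h') (hT hx)
        · exact base_notMem_int_image h'
      | circle =>
        obtain ⟨d, hd, -, rfl, -⟩ := hcirc h.1
        exact absurd (Or.inr ⟨Or.inl ⟨x, hx, rfl⟩, Or.inr (Or.inr ⟨d, hd, rfl⟩)⟩) h.2.2
  · intro a n b h
    obtain ⟨d, hd, -, rfl, -⟩ := hcirc h.1
    exact Or.inl (Or.inr ⟨d, hd, rfl⟩)
  · intro a n b n' b' h h'
    obtain ⟨d, -, h1, rfl, -⟩ := hcirc h.1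
    obtain ⟨d', -, h2, rfl, -⟩ := hcirc h'.1
    cases h1.symm.trans h2
    rfl
  · intro a n b n' b' h h'
    obtain ⟨d, -, rfl, rfl, hd⟩ := hcirc h.1
    apply hd
    rcases b' with b' | b'
    · exact ⟨b', Or.inl ⟨_, h'.1⟩⟩
    · obtain ⟨c, hc⟩ := SoftEdge.arrowAt h'.1.2.2
      exact ⟨c, Or.inl hc⟩

/-! ### Ancestors in softly manipulated graphs -/

section Soft

variable {G : MixedGraph α} {D S : Set α}

theorem softADMG_reach_base {a : α} {x : Node α} :
    Relation.ReflTransGen (G.softADMG D).Directed (.base a) x ↔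
      ∃ b, x = .base b ∧ Relation.ReflTransGen G.Directed a b := by
  constructor
  · intro h
    induction h with
    | refl => exact ⟨a, rfl, .refl⟩
    | @tail y z _ e ih =>
      obtain ⟨b, rfl, hb⟩ := ih
      rcases z with z | z
      · exact ⟨z, rfl, hb.tail e⟩
      · exact absurd e.2.1 (by simp)
  · rintro ⟨b, rfl, h⟩
    exact h.lift Node.base fun _ _ e => e

theorem softADMG_acyclic (hG : G.IsIADMG) (x : Node α) :
    ¬ Relation.TransGen (G.softADMG D).Directed x x := by
  intro h
  rcases x with x | x
  · obtain ⟨y, e, h⟩ := Relation.TransGen.head'_iff.1 h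
    rcases y with y | y
    · obtain ⟨b, hb, h⟩ := softADMG_reach_base.1 h
      cases hb
      exact hG.acyclic x (Relation.TransGen.head' e h)
    · exact absurd e.2.1 (by simp)
  · obtain ⟨y, -, e⟩ := Relation.TransGen.tail'_iff.1 h
    rcases y with y | y
    · exact absurd e.2.1 (by simp)
    · exact e

theorem softADMG_mem_anc {a : α} :
    Node.base a ∈ (G.softADMG D).Anc (Node.base '' S) ↔ a ∈ G.Anc S := by
  constructor
  · rintro ⟨_, ⟨x, hx, rfl⟩, h⟩
    obtain ⟨b, hb, h⟩ := softADMG_reach_base.1 h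
    cases hb
    exact ⟨x, hx, h⟩
  · rintro ⟨x, hx, h⟩
    exact ⟨_, ⟨x, hx, rfl⟩, softADMG_reach_base.2 ⟨x, rfl, h⟩⟩

theorem softADMG_ancTo_base {a b : α} :
    (G.softADMG D).AncTo (Node.base '' S) (.base a) (.base b) ↔ G.AncTo S a b := by
  rw [ancTo_iff, ancTo_iff, softADMG_mem_anc, softADMG_reach_base]
  simp

theorem softADMG_ancTo_int {a d : α} :
    (G.softADMG D).AncTo (Node.base '' S) (.base a) (.int d) ↔ a ∈ G.Anc S := by
  rw [ancTo_iff, softADMG_mem_anc, softADMG_reach_base]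
  simp

/-- Collider walks of a softly manipulated graph use intervention nodes only as endnodes, since
these have no arrowheads. -/
theorem softADMG_colliderWalk {P : Node α → Prop} {a : α} {m n : Mark} {x : Node α}
    (h : (G.softADMG D).ColliderWalk P (.base a) m n x) :
    (∃ b, x = .base b ∧ G.ColliderWalk (fun v => P (.base v)) a m n b) ∨
      ∃ d, x = .int d ∧ d ∈ D ∩ G.outputs ∧
        (a = d ∨ P (.base d) ∧ G.ColliderWalk (fun v => P (.base v)) a m Mark.arrow d) := by
  generalize hy : Node.base a = y at h
  induction h generalizing a with
  | @edge _ m n x e =>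
    subst hy
    rcases x with x | x
    · exact Or.inl ⟨x, rfl, .edge e⟩
    · exact Or.inr ⟨x, rfl, e.1, Or.inl e.2.2.2.1⟩
  | @cons _ m v n x e hP _ ih =>
    subst hy
    rcases v with v | v
    · rcases ih rfl with ⟨b, rfl, hb⟩ | ⟨d, rfl, hd, rfl | ⟨hPd, hw⟩⟩
      · exact Or.inl ⟨b, rfl, .cons e hP hb⟩
      · exact Or.inr ⟨v, rfl, hd, Or.inr ⟨hP, .edge e⟩⟩
      · exact Or.inr ⟨d, rfl, hd, Or.inr ⟨hPd, .cons e hP hw⟩⟩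
    · exact absurd e.2.1 (by simp)

end Soft

/-! ### Marks of a represented graph along inducing walks -/

section Represents

variable {M : MixedGraph α} {𝔄 : ISADMG α}

theorem Represents.mem_nodes (h : M.Represents 𝔄) {a : α} (ha : a ∈ 𝔄.graph.nodes)
    (hS : a ∉ 𝔄.sel) : a ∈ M.nodes := by
  rcases ha with ha | ha
  · exact Or.inl (h.inputs_eq ▸ ha)
  · exact Or.inr (h.outputs_eq ▸ ⟨ha, hS⟩)

theorem Represents.notMem_sel (h : M.Represents 𝔄) {a : α} (ha : a ∈ M.nodes) : a ∉ 𝔄.sel := by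
  rcases ha with ha | ha
  · intro hS
    exact Set.disjoint_left.1 𝔄.graph.disjoint (h.inputs_eq ▸ ha) (𝔄.sel_subset hS)
  · exact (h.outputs_eq ▸ ha : a ∈ 𝔄.observed).2

theorem notMem_inputs_of_arrowAt (hM : M.IsIMAG) {a b : α} (h : M.ArrowAt a b) : a ∉ M.inputs :=
  fun ha => hM.no_arrow_input ha h

theorem adj_mem_nodes {a b : α} (h : M.Adj a b) : a ∈ M.nodes ∧ b ∈ M.nodes := by
  obtain ⟨m, n, e⟩ := h
  exact ⟨M.edge_mem e, M.edge_mem (M.edge_symm e)⟩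

/-- The marks of an iMAG at adjacent nodes are determined by the ancestors in the represented
graph. -/
theorem Represents.tail_iff (hM : M.IsIMAG) (h : M.Represents 𝔄) {a b : α} {m n : Mark}
    (e : M.edge a m n b) : m = Mark.tail ↔ 𝔄.graph.AncTo 𝔄.sel a b := by
  constructor
  · rintro rfl
    exact h.tail a b ⟨_, e⟩
  · intro ha
    cases m with
    | tail => rfl
    | arrow => exact absurd ha (h.arrow a b ⟨_, e⟩)
    | circle => exact absurd rfl (hM.no_circle e).1

theorem Represents.arrow_iff (hM : M.IsIMAG) (h : M.Represents 𝔄) {a b : α} {m n : Mark}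
    (e : M.edge a m n b) : m = Mark.arrow ↔ ¬ 𝔄.graph.AncTo 𝔄.sel a b := by
  rw [← h.tail_iff hM e]
  have := (hM.no_circle e).1
  cases m <;> simp_all

/-- A tail at the first node of an inducing walk makes this node an ancestor of the last node or of
`S`, since it is a parent of the next node on the walk. -/
theorem IsIADMG.ancTo_of_tail {G : MixedGraph α} {S : Set α} (hG : G.IsIADMG) {a b : α} {n : Mark}
    (h : G.ColliderWalk (fun v => G.AncTo S v a ∨ G.AncTo S v b) a Mark.tail n b) :
    G.AncTo S a b := by
  cases h with
  | edge e =>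
    obtain rfl := hG.arrow_of_tail e
    exact AncTo.of_directed e
  | cons e hP _ =>
    have h1 : G.AncTo S a _ := AncTo.of_directed e
    rcases hP with hP | hP
    · exact AncTo.of_anc (h1.anc_of_antisymm hG.acyclic hP (G.edge_ne e))
    · exact h1.trans hP

theorem ColliderWalk.mark_eq {G : MixedGraph α} (hG : G.IsIADMG) {P : α → Prop} {a b : α}
    {m n : Mark} (h : G.ColliderWalk P a m n b) : m = Mark.tail ∨ m = Mark.arrow := by
  obtain ⟨k, v, e⟩ := h.exists_edge_left
  rcases hG.edge_type e with h | h | h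
  · exact Or.inl h.1
  · exact Or.inr h.1
  · exact Or.inr h.1

/-- An edge of an iMAG stems from an inducing walk which has all the arrowheads of the edge. -/
theorem Represents.exists_inducing_walk (h : M.Represents 𝔄) {a b : α}
    {m n : Mark} (e : M.edge a m n b) :
    ∃ m' n', 𝔄.graph.ColliderWalk (fun v => 𝔄.graph.AncTo 𝔄.sel v a ∨ 𝔄.graph.AncTo 𝔄.sel v b)
      a m' n' b ∧ (m = Mark.arrow → m' = Mark.arrow) ∧ (n = Mark.arrow → n' = Mark.arrow) := by
  have hab := M.edge_ne e
  obtain ⟨ha, hb⟩ := adj_mem_nodes ⟨m, n, e⟩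
  obtain ⟨m', n', w⟩ := (((h.adj_iff a ha b hb hab).1 ⟨m, n, e⟩).2).exists_colliderWalk hab
  have w' : 𝔄.graph.ColliderWalk (fun v => 𝔄.graph.AncTo 𝔄.sel v a ∨ 𝔄.graph.AncTo 𝔄.sel v b)
      a m' n' b := w.mono fun v _ _ hv => mem_anc_pair_iff.1 hv
  refine ⟨m', n', w', ?_, ?_⟩
  · rintro rfl
    refine (w'.mark_eq 𝔄.isIADMG).resolve_left ?_
    rintro rfl
    exact h.arrow a b ⟨_, e⟩ (𝔄.isIADMG.ancTo_of_tail w')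
  · rintro rfl
    have w'' := w'.symm.mono fun v _ _ hv => Or.symm hv
    refine (w''.mark_eq 𝔄.isIADMG).resolve_left ?_
    rintro rfl
    exact h.arrow b a ⟨_, M.edge_symm e⟩ (𝔄.isIADMG.ancTo_of_tail w'')

theorem Represents.adj_of_walk (h : M.Represents 𝔄) {a b : α} {m n : Mark} (ha : a ∈ M.nodes)
    (hb : b ∈ M.nodes) (hab : a ≠ b) (hI : ¬ (a ∈ M.inputs ∧ b ∈ M.inputs))
    (w : 𝔄.graph.ColliderWalk (fun v => 𝔄.graph.AncTo 𝔄.sel v a ∨ 𝔄.graph.AncTo 𝔄.sel v b)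
      a m n b) : M.Adj a b :=
  (h.adj_iff a ha b hb hab).2
    ⟨hI, (w.mono fun _ _ _ hv => mem_anc_pair_iff.2 hv).hasInducingPath hab⟩

/-- Collider walks of an iMAG all of whose non-endnodes are parents of `u` can be replaced by
collider walks of the represented graph. -/
theorem Represents.lift_colliderWalk (h : M.Represents 𝔄) {P : α → Prop}
    {u : α} (hu : ∀ v, 𝔄.graph.AncTo 𝔄.sel v u → P v) {a b : α} {m n : Mark}
    (w : M.ColliderWalk (fun v => M.Directed v u) a m n b)
    (ha : ∀ v, 𝔄.graph.AncTo 𝔄.sel v a → P v) (hb : 𝔄.graph.AncTo 𝔄.sel b u) :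
    ∃ m' n', 𝔄.graph.ColliderWalk P a m' n' b ∧ (m = Mark.arrow → m' = Mark.arrow) ∧
      (n = Mark.arrow → n' = Mark.arrow) := by
  induction w with
  | edge e =>
    obtain ⟨m', n', w', hm, hn⟩ := h.exists_inducing_walk e
    exact ⟨m', n', w'.mono fun v _ _ hv => hv.elim (ha v) fun hv => hu v (hv.trans hb), hm, hn⟩
  | cons e hv _ ih =>
    have hvu := h.tail _ _ ⟨_, hv⟩
    obtain ⟨m₁, n₁, w₁, hm₁, hn₁⟩ := h.exists_inducing_walk e
    obtain ⟨m₂, n₂, w₂, hm₂, hn₂⟩ := ih (fun x hx => hu x (hx.trans hvu)) hb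
    obtain rfl := hn₁ rfl
    obtain rfl := hm₂ rfl
    refine ⟨m₁, n₂, .trans (w₁.mono fun x _ _ hx => ?_) (hu _ hvu) w₂, hm₁, hn₂⟩
    exact hx.elim (ha x) fun hx => hu x (hx.trans hvu)

/-- If `d → u` is visible, then no represented graph has an inducing walk between `u` and `d` with
an arrowhead at `d`: together with the collider path into `d` it would make the first node of this
path adjacent to `u`. -/
theorem Represents.not_visible (hM : M.IsIMAG) (h : M.Represents 𝔄) {d u : α} {m : Mark}
    (hdu : M.Directed d u)
    (w : 𝔄.graph.ColliderWalk (fun v => 𝔄.graph.AncTo 𝔄.sel v u ∨ 𝔄.graph.AncTo 𝔄.sel v d)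
      u m Mark.arrow d) : ¬ M.Visible d u := by
  rintro (hd | ⟨-, c, hc, hcu, π, -, hft, hlen, hsnd, hin⟩)
  · obtain ⟨k, v, e⟩ := w.symm.exists_edge_left
    exact 𝔄.isIADMG.no_arrow_input (h.inputs_eq ▸ hd) ⟨_, e⟩
  have hdA : 𝔄.graph.AncTo 𝔄.sel d u := h.tail _ _ ⟨_, hdu⟩
  obtain ⟨k, hk⟩ := Nat.exists_eq_add_of_le' hlen
  have wM : M.ColliderWalk (fun v => M.Directed v u) c (π.fst 0) Mark.arrow d := by
    have := colliderWalk_of_segment (G := M) (P := fun v => M.Directed v u) π.node π.fst π.snd 0 k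
      (fun j _ _ => π.edge j (by omega))
      (fun j _ _ => ⟨hsnd j (by omega), hin (j + 1) (by omega) (by omega)⟩)
    rwa [show 0 + k + 1 = π.length by omega, hft.1, hft.2, hsnd _ (by omega)] at this
  have hne : c ≠ u := by
    rintro rfl
    have : ∃ m v, M.edge c m Mark.arrow v ∧ M.Directed v c := by
      cases wM with
      | edge e => exact ⟨_, _, e, hdu⟩
      | cons e hv _ => exact ⟨_, _, e, hv⟩
    obtain ⟨m, v, e, e'⟩ := this
    have := (hM.simple (M.edge_symm e) e').1
    cases this
  have huI : u ∉ M.inputs := notMem_inputs_of_arrowAt hM ⟨_, M.edge_symm hdu⟩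
  have huN : u ∈ M.nodes := (adj_mem_nodes ⟨_, _, hdu⟩).2
  obtain ⟨m', n', w', -, hn'⟩ := h.lift_colliderWalk
    (P := fun v => 𝔄.graph.AncTo 𝔄.sel v c ∨ 𝔄.graph.AncTo 𝔄.sel v u)
    (fun v hv => Or.inr hv) wM (fun v hv => Or.inl hv) hdA
  obtain rfl := hn' rfl
  refine hcu (h.adj_of_walk (n := m) hc huN hne (fun hI => huI hI.2) (.trans w' (Or.inr hdA) ?_))
  exact w.symm.mono fun v _ _ hv => Or.inr (hv.elim id fun hv => hv.trans hdA)

end Represents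

/-! ### From represented graphs to the iMAG -/

section Soundness

variable {M : MixedGraph α} {𝔄 : ISADMG α} {D T : Set α}

/-- Every link of the manipulated represented graph is an edge of the manipulated iMAG, the marks of
which follow the ancestors; only the mark at a node next to its intervention node may be a
circle. -/
theorem Represents.exists_edge_doMAG (hM : M.IsIMAG) (h : M.Represents 𝔄) (hD : D ⊆ M.outputs)
    (hDT : Disjoint D T) {a : α} {x : Node α} {m n : Mark} (hax : .base a ≠ x)
    (ha : a ∈ M.outputs) (haT : a ∉ T)
    (hxT : x ∉ Node.base '' T) (hxS : x ∉ Node.base '' 𝔄.sel)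
    (w : (𝔄.graph.softADMG D).ColliderWalk
      (fun v => (𝔄.graph.softADMG D).AncTo (Node.base '' 𝔄.sel) v (.base a) ∨
        (𝔄.graph.softADMG D).AncTo (Node.base '' 𝔄.sel) v x) (.base a) m n x) :
    ∃ m' n', (M.doMAG D T).edge (.base a) m' n' x ∧
      ((𝔄.graph.softADMG D).AncTo (Node.base '' 𝔄.sel) (.base a) x → m' ≠ Mark.arrow) ∧
      (¬ (𝔄.graph.softADMG D).AncTo (Node.base '' 𝔄.sel) (.base a) x → m' ≠ Mark.tail) ∧
      (∀ b, x = .base b →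
        ((𝔄.graph.softADMG D).AncTo (Node.base '' 𝔄.sel) x (.base a) → n' = Mark.tail) ∧
        (¬ (𝔄.graph.softADMG D).AncTo (Node.base '' 𝔄.sel) x (.base a) → n' = Mark.arrow)) := by
  have haI : a ∉ M.inputs := fun hI => Set.disjoint_left.1 M.disjoint hI ha
  rcases softADMG_colliderWalk w with ⟨b, rfl, wb⟩ | ⟨d, rfl, hd, hw⟩
  · have hbS : b ∉ 𝔄.sel := by simpa using hxS
    have hb : b ∈ M.nodes := by
      obtain ⟨k, v, e⟩ := wb.symm.exists_edge_left
      exact h.mem_nodes (𝔄.graph.edge_mem e) hbS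
    have hab : a ≠ b := fun hab => hax (by rw [hab])
    obtain ⟨m', n', e⟩ := h.adj_of_walk (Or.inr ha) hb hab (fun hI => haI hI.1)
      (wb.mono fun v _ _ hv => by simpa only [softADMG_ancTo_base] using hv)
    refine ⟨m', n', doMAG_edge_of e haI haT hxT, ?_⟩
    simp only [Node.base.injEq, forall_eq', softADMG_ancTo_base]
    refine ⟨?_, ?_, (h.tail_iff hM (M.edge_symm e)).2, (h.arrow_iff hM (M.edge_symm e)).2⟩
    · intro hA
      rw [(h.tail_iff hM e).2 hA]
      simp
    · intro hA
      rw [(h.arrow_iff hM e).2 hA]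
      simp
  · have hdM : d ∈ M.outputs := hD hd.1
    have hdT : d ∉ T := fun hT => Set.disjoint_left.1 hDT hd.1 hT
    have hdI : d ∉ M.inputs := fun hI => Set.disjoint_left.1 M.disjoint hI hdM
    simp only [reduceCtorEq, false_imp_iff, implies_true, and_true, softADMG_ancTo_int]
    obtain rfl | ⟨had, hP, hw⟩ : a = d ∨ a ≠ d ∧ _ :=
      or_iff_not_imp_left.2 fun had => ⟨had, hw.resolve_left had⟩
    · by_cases hc1 : ∃ c, M.ArrowAt a c
      · refine ⟨_, _, doMAG_edge_of (softMAG_edge_int.2 ⟨⟨hd.1, ha⟩, rfl, ha,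
          Or.inl ⟨rfl, rfl, hc1⟩⟩) haI haT (by simp), fun hA => ?_, by simp⟩
        obtain ⟨c, hc⟩ := hc1
        exact absurd (AncTo.of_anc hA) (h.arrow a c hc)
      by_cases hc2 : ∃ c, M.Undirected a c
      · refine ⟨_, _, doMAG_edge_of (softMAG_edge_int.2 ⟨⟨hd.1, ha⟩, rfl, ha,
          Or.inr (Or.inl ⟨rfl, rfl, hc2⟩)⟩) haI haT (by simp), by simp, fun hA => ?_⟩
        obtain ⟨c, hc⟩ := hc2
        exact absurd (AncTo.anc_of_antisymm 𝔄.isIADMG.acyclic (h.tail a c ⟨_, hc⟩)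
          (h.tail c a ⟨_, M.edge_symm hc⟩) (M.edge_ne hc)) hA
      · refine ⟨_, _, doMAG_edge_of (softMAG_edge_int.2 ⟨⟨hd.1, ha⟩, rfl, ha,
          Or.inr (Or.inr (Or.inl ⟨rfl, rfl, ?_⟩))⟩) haI haT (by simp), by simp, by simp⟩
        rintro ⟨c, hc | hc⟩
        · exact hc1 ⟨c, hc⟩
        · exact hc2 ⟨c, hc⟩
    · have hda : 𝔄.graph.AncTo 𝔄.sel d a := by
        simp only [softADMG_ancTo_base, softADMG_ancTo_int] at hP
        exact hP.elim id AncTo.of_anc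
      have hw' : 𝔄.graph.ColliderWalk
          (fun v => 𝔄.graph.AncTo 𝔄.sel v a ∨ 𝔄.graph.AncTo 𝔄.sel v d) a m Mark.arrow d := by
        refine hw.mono fun v _ _ hv => Or.inl ?_
        simp only [softADMG_ancTo_base, softADMG_ancTo_int] at hv
        exact hv.elim id AncTo.of_anc
      obtain ⟨m', n', e⟩ := h.adj_of_walk (Or.inr ha) (Or.inr hdM) had (fun hI => haI hI.1) hw'
      obtain rfl := (h.tail_iff hM (M.edge_symm e)).2 hda
      by_cases hA : a ∈ 𝔄.graph.Anc 𝔄.sel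
      · obtain rfl := (h.tail_iff hM e).2 (AncTo.of_anc hA)
        exact ⟨_, _, doMAG_edge_of (softMAG_edge_int.2 ⟨⟨hd.1, hdM⟩, rfl, ha,
          Or.inr (Or.inr (Or.inr (Or.inr ⟨rfl, M.edge_symm e⟩)))⟩) haI haT (by simp),
          by simp, fun h' => absurd hA h'⟩
      · have hm' := (h.arrow_iff hM e).2 fun hA' =>
          hA (hA'.anc_of_antisymm 𝔄.isIADMG.acyclic hda had)
        subst hm'
        exact ⟨_, _, doMAG_edge_of (softMAG_edge_int.2 ⟨⟨hd.1, hdM⟩, rfl, ha,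
          Or.inr (Or.inr (Or.inr (Or.inl ⟨rfl, M.edge_symm e,
            h.not_visible hM (M.edge_symm e) hw'⟩)))⟩) haI haT (by simp),
          fun h' => absurd h' hA, by simp⟩

/-- The inducing links of the manipulated represented graph that start at a noninput node. -/
abbrev DoLink (𝔄 : ISADMG α) (D T : Set α) :=
  Link (𝔄.graph.softADMG D) (Node.base '' 𝔄.sel) (𝔄.graph.doADMG D T).inputs

theorem Link.exists_eq_base (x : DoLink 𝔄 D T) :
    ∃ a, x.s = .base a ∧ a ∈ 𝔄.graph.outputs ∧ a ∉ T := by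
  obtain ⟨k, v, e⟩ := x.walk.exists_edge_left
  have hI := x.not_mem
  have hn := (𝔄.graph.softADMG D).edge_mem e
  rcases hn with hn | ⟨a, ha, hax⟩
  · exact absurd (Or.inl hn) hI
  · refine ⟨a, hax.symm, ha, fun haT => ?_⟩
    rw [← hax] at hI
    exact (base_notMem_inputs_doADMG.1 hI).2 haT ha

/-- An open walk decomposes into single edges, which are links. -/
theorem OpenTo.exists_chain {Z O : Set (Node α)} {a b : Node α} {m : Mark}
    (w : (𝔄.graph.doADMG D T).OpenTo Z O b a m) :
    ∃ l : List (DoLink 𝔄 D T), l ≠ [] ∧ (∀ x ∈ l.head?, x.s = a ∧ x.m = m) ∧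
      (∀ x ∈ l.getLast?, x.t = b) ∧
      l.IsChain (Link.Joined Z ((𝔄.graph.doADMG D T).Anc (Z ∩ O))) := by
  induction w with
  | @edge a m n ha e =>
    exact ⟨[⟨a, m, n, b, MixedGraph.edge_ne _ e, ha, .edge e.1⟩], by simp, by simp, by simp,
      by simp⟩
  | @cons a m n v m' ha e hv _ ih =>
    obtain ⟨l, hl, hhead, hlast, hchain⟩ := ih
    obtain ⟨y, l, rfl⟩ := List.exists_cons_of_ne_nil hl
    obtain ⟨rfl, rfl⟩ := hhead y (by simp)
    refine ⟨⟨a, m, n, y.s, MixedGraph.edge_ne _ e, ha, .edge e.1⟩ :: y :: l, by simp, by simp,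
      by simpa using hlast, ?_⟩
    rw [List.isChain_cons_cons]
    refine ⟨⟨rfl, ?_⟩, hchain⟩
    rcases hv with ⟨hn | hm, hZ⟩ | ⟨hn, hm, hK⟩
    · refine Or.inl ⟨hZ, Or.inl (AncTo.of_directed ?_)⟩
      subst hn
      exact softADMG_directed_of_tail 𝔄.isIADMG ((𝔄.graph.softADMG D).edge_symm e.1)
    · refine Or.inl ⟨hZ, Or.inr ?_⟩
      have w := y.walk
      rw [hm] at w
      cases w with
      | edge e' => exact AncTo.of_directed (softADMG_directed_of_tail 𝔄.isIADMG e')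
      | cons e' hP _ =>
        have h1 : (𝔄.graph.softADMG D).AncTo (Node.base '' 𝔄.sel) y.s _ := AncTo.of_directed e'
        rcases hP with hP | hP
        · exact AncTo.of_anc
            (h1.anc_of_antisymm (softADMG_acyclic 𝔄.isIADMG) hP (MixedGraph.edge_ne _ e'))
        · exact h1.trans hP
    · exact Or.inr ⟨hn, hm, hK⟩

/-- Directed paths that do not lead to selection nodes are inherited by the iMAG. -/
theorem Represents.anc_doMAG (hM : M.IsIMAG) (h : M.Represents 𝔄) {C : Set (Node α)}
    {a : α} (ha : a ∈ M.outputs) (haT : a ∉ T) (haS : a ∉ 𝔄.graph.Anc 𝔄.sel)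
    (hA : .base a ∈ (𝔄.graph.doADMG D T).Anc
      ((C ∪ Node.base '' T ∪ Node.base '' 𝔄.sel) ∩ Node.base '' 𝔄.graph.outputs)) :
    .base a ∈ (M.doMAG D T).Anc ((C ∪ Node.base '' T) ∩ Node.base '' M.outputs) := by
  obtain ⟨x, hx, hax⟩ := hA
  generalize hy : Node.base a = y at hax
  induction hax using Relation.ReflTransGen.head_induction_on generalizing a with
  | refl =>
    subst hy
    rcases hx.1 with hx' | hx'
    · exact ⟨_, ⟨hx', _, ha, rfl⟩, .refl⟩
    · exact absurd ⟨a, by simpa using hx', .refl⟩ haS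
  | @head y z e _ ih =>
    subst hy
    rcases z with b | d
    · have hab : 𝔄.graph.Directed a b := e.1
      have hbT : b ∉ T := fun hb => e.2.1 ⟨⟨b, hb, rfl⟩, rfl⟩
      have hbS : b ∉ 𝔄.graph.Anc 𝔄.sel := fun hb => haS (anc_trans (.single hab) hb)
      have hb : b ∈ M.outputs := by
        rw [h.outputs_eq]
        refine ⟨?_, fun hS => hbS ⟨b, hS, .refl⟩⟩
        refine (𝔄.graph.edge_mem (𝔄.graph.edge_symm hab)).resolve_left fun hI => ?_
        exact 𝔄.isIADMG.no_arrow_input hI ⟨_, 𝔄.graph.edge_symm hab⟩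
      have haI : a ∉ M.inputs := fun hI => Set.disjoint_left.1 M.disjoint hI ha
      have hne := 𝔄.graph.edge_ne hab
      obtain ⟨m, n, e'⟩ := h.adj_of_walk (Or.inr ha) (Or.inr hb) hne (fun hI => haI hI.1)
        (.edge hab)
      have hAab : 𝔄.graph.AncTo 𝔄.sel a b := AncTo.of_directed hab
      obtain rfl := (h.tail_iff hM e').2 hAab
      obtain rfl := (h.arrow_iff hM (M.edge_symm e')).2 fun hba =>
        haS (hAab.anc_of_antisymm 𝔄.isIADMG.acyclic hba hne)
      have e'' : (M.doMAG D T).Directed (.base a) (.base b) :=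
        doMAG_edge_of e' haI haT (by simpa using hbT)
      exact anc_trans (.single e'') (ih hb hbT hbS rfl)
    · exact absurd e.1.2.1 (by simp)

/-- The links of a reduced chain are edges of the manipulated iMAG that form an open walk.  The
conditions on the first mark are those needed for extending the walk to the left. -/
theorem Represents.openTo_doMAG_of_chain (hM : M.IsIMAG) (h : M.Represents 𝔄) (hD : D ⊆ M.outputs)
    (hT : T ⊆ M.outputs) (hDT : Disjoint D T) {C : Set (Node α)} {b : Node α}
    (hbT : b ∉ Node.base '' T) (hbS : b ∉ Node.base '' 𝔄.sel) (x : DoLink 𝔄 D T)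
    (l : List (DoLink 𝔄 D T)) (hx : x.s ∉ Node.base '' 𝔄.sel)
    (hb : ∀ y ∈ (x :: l).getLast?, y.t = b)
    (hl : (x :: l).IsChain (Link.JoinedReduced (C ∪ Node.base '' T ∪ Node.base '' 𝔄.sel)
      ((𝔄.graph.doADMG D T).Anc
        ((C ∪ Node.base '' T ∪ Node.base '' 𝔄.sel) ∩ Node.base '' 𝔄.graph.outputs)))) :
    ∃ m, (M.doMAG D T).OpenTo (C ∪ Node.base '' T) (Node.base '' M.outputs) b x.s m ∧
      ((𝔄.graph.softADMG D).AncTo (Node.base '' 𝔄.sel) x.s x.t → m ≠ Mark.arrow) ∧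
      (¬ (𝔄.graph.softADMG D).AncTo (Node.base '' 𝔄.sel) x.s x.t → m ≠ Mark.tail) ∧
      ∃ k v, (M.doMAG D T).edge x.s m k v := by
  have hout : ∀ {a}, a ∈ 𝔄.graph.outputs → .base a ∉ Node.base '' 𝔄.sel → a ∈ M.outputs := by
    intro a ha hS
    rw [h.outputs_eq]
    exact ⟨ha, by simpa using hS⟩
  have hnI : ∀ {a}, a ∈ M.outputs → a ∉ T → .base a ∉ (M.doMAG D T).inputs := fun ha haT =>
    base_notMem_inputs_doMAG.2
      ⟨fun hI => Set.disjoint_left.1 M.disjoint hI ha, fun h => absurd h haT⟩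
  induction l generalizing x with
  | nil =>
    obtain rfl := hb x (by simp)
    obtain ⟨a, hxa, ha, haT⟩ := x.exists_eq_base
    have w := x.walk
    have hne := x.ne
    rw [hxa] at w hne hx ⊢
    have haM := hout ha hx
    obtain ⟨m, n, e, h1, h2, -⟩ := h.exists_edge_doMAG hM hD hDT hne haM haT hbT hbS w
    exact ⟨m, .edge (hnI haM haT) e, h1, h2, _, _, e⟩
  | cons y l ih =>
    rw [List.isChain_cons_cons] at hl
    obtain ⟨⟨hxy, hj⟩, hl⟩ := hl
    obtain ⟨a, hxa, ha, haT⟩ := x.exists_eq_base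
    obtain ⟨c, hyc, hc, hcT⟩ := y.exists_eq_base
    have hyS : y.s ∉ Node.base '' 𝔄.sel := by
      rcases hj with hj | hj
      · exact fun hS => hj.1 (Or.inr hS)
      · exact fun hS => hj.2.2.2 (Or.inl (AncTo.of_anc ⟨_, hS, .refl⟩))
    obtain ⟨m', hopen, hm1, hm2, k, v, e'⟩ := ih y hyS (by simpa using hb) hl
    have w := x.walk
    have hne := x.ne
    rw [hxy] at w hne ⊢
    rw [hxa] at w hne hx hj ⊢
    rw [hyc] at w hne hj hyS hopen hm1 hm2 e' ⊢
    have haM := hout ha hx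
    have hcM := hout hc hyS
    obtain ⟨m, n, e, h1, h2, h3⟩ := h.exists_edge_doMAG hM hD hDT hne haM haT (by simpa using hcT)
      hyS w
    have h3 := h3 c rfl
    have hcirc : m' = Mark.circle → n ≠ Mark.arrow := by
      rintro rfl rfl
      exact (tame_doMAG hM D hT).not_arrow_of_circle e' ((M.doMAG D T).edge_symm e)
    refine ⟨m, .cons (hnI haM haT) e ?_ hopen, h1, h2, _, _, e⟩
    rcases hj with ⟨hZ, hj⟩ | ⟨-, -, hK, hj⟩
    · refine Or.inl ⟨?_, fun hC => hZ (Or.inl hC)⟩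
      by_cases hn : n = Mark.tail
      · exact Or.inl hn
      have hca : ¬ (𝔄.graph.softADMG D).AncTo (Node.base '' 𝔄.sel) (.base c) (.base a) :=
        fun h => hn (h3.1 h)
      have hn' := h3.2 hca
      have hm := hm1 (hj.resolve_left hca)
      cases m' with
      | tail => exact Or.inr rfl
      | arrow => exact absurd rfl hm
      | circle => exact absurd hn' (hcirc rfl)
    · rw [not_or] at hj
      have hn := h3.2 hj.1
      refine Or.inr ⟨hn, ?_, h.anc_doMAG hM hcM hcT ?_ hK⟩
      · cases m' with
        | tail => exact absurd rfl (hm2 hj.2)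
        | arrow => rfl
        | circle => exact absurd hn (hcirc rfl)
      · exact fun hS => hj.1 (AncTo.of_anc (softADMG_mem_anc.2 hS))

/-- An open walk of a manipulated represented graph gives an open walk with the same endnodes of the
manipulated iMAG. -/
theorem Represents.openTo_doMAG (hM : M.IsIMAG) (h : M.Represents 𝔄) (hD : D ⊆ M.outputs)
    (hT : T ⊆ M.outputs) (hDT : Disjoint D T) {C : Set (Node α)} {a b : Node α} {m : Mark}
    (hab : a ≠ b) (haS : a ∉ Node.base '' 𝔄.sel) (hbT : b ∉ Node.base '' T)
    (hbS : b ∉ Node.base '' 𝔄.sel)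
    (w : (𝔄.graph.doADMG D T).OpenTo (C ∪ Node.base '' T ∪ Node.base '' 𝔄.sel)
      (Node.base '' 𝔄.graph.outputs) b a m) :
    ∃ m, (M.doMAG D T).OpenTo (C ∪ Node.base '' T) (Node.base '' M.outputs) b a m := by
  obtain ⟨l, hl, hhead, hlast, hchain⟩ := w.exists_chain
  obtain ⟨l, hl, hhead, hlast, hchain⟩ := Link.exists_reduced_chain
    (softADMG_acyclic 𝔄.isIADMG) hab l hl (fun x hx => (hhead x hx).1) hlast hchain
  obtain ⟨x, l, rfl⟩ := List.exists_cons_of_ne_nil hl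
  obtain rfl := hhead x (by simp)
  obtain ⟨m, hm, -⟩ := h.openTo_doMAG_of_chain hM hD hT hDT hbT hbS x l haS hlast hchain
  exact ⟨m, hm⟩

end Soundness

/-! ### Canonical representatives -/

theorem IsIMAG.tail_or_arrow {M : MixedGraph α} (hM : M.IsIMAG) {a b : α} {m n : Mark}
    (e : M.edge a m n b) : m = Mark.tail ∨ m = Mark.arrow := by
  have := (hM.no_circle e).1
  cases m <;> simp_all

section Bridge

variable {M : MixedGraph α} {P : α → Prop} {d u : α}

/-- If `d → u` is invisible and a collider path of parents of `u` leads from `e` via `x` into `d`,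
then `e` is adjacent to `u`, and ancestrality forces an arrowhead at `u`. -/
theorem IsIMAG.exists_edge_of_not_visible (hM : M.IsIMAG) (hd : d ∈ M.outputs)
    (hdu : M.Directed d u) (hv : ¬ M.Visible d u) {e x : α} {m : Mark}
    (hex : M.edge e m Mark.arrow x) (hxu : M.Directed x u)
    (hx : x = d ∨ M.ColliderWalk (fun v => M.Directed v u) x Mark.arrow Mark.arrow d) :
    (∃ k, M.edge e k Mark.arrow u) ∧
      M.ColliderWalk (fun v => M.Directed v u) e m Mark.arrow d := by
  have w : M.ColliderWalk (fun v => M.Directed v u) e m Mark.arrow d := by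
    rcases hx with rfl | hx
    · exact .edge hex
    · exact .cons hex hxu hx
  refine ⟨?_, w⟩
  have hadj : M.Adj e u := by
    by_contra hadj
    have hed : e ≠ d := by
      rintro rfl
      exact hadj ⟨_, _, hdu⟩
    obtain ⟨π, hpath, hft, hlen, hcol, -, hlast⟩ := w.exists_path hed
    refine hv (Or.inr ⟨hd, e, M.edge_mem hex, hadj, π, hpath, hft, hlen, ?_, ?_⟩)
    · intro i hi
      by_cases hi' : i + 1 < π.length
      · exact (hcol i hi').1.1
      · rw [show i = π.length - 1 by omega]
        exact hlast.elim id id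
    · intro i h1 hi
      obtain ⟨j, rfl⟩ := Nat.exists_eq_add_of_le' h1
      exact ⟨(hcol j hi).1.2, (hcol j hi).2⟩
  obtain ⟨k, k', e'⟩ := hadj
  rcases hM.tail_or_arrow (M.edge_symm e') with rfl | rfl
  · exfalso
    rcases hM.tail_or_arrow e' with rfl | rfl
    · exact hM.no_arrow_undirected _ _ _ ⟨_, M.edge_symm hdu⟩ (M.edge_symm e')
    · have hue : M.Directed u e := M.edge_symm e'
      rcases hM.tail_or_arrow hex with rfl | rfl
      · exact hM.no_directed_cycle e (.head hex (.head hxu (.single hue)))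
      · exact hM.no_almost_directed_cycle x e (.head hxu (.single hue)) hex
  · exact ⟨k, e'⟩

/-- If `d → u` is invisible, then a collider walk into `d` can be redirected into `u`: going
backwards from `d`, one meets parents of `u` up to a node with an edge `⋆→ u` that can serve as a
shortcut. -/
theorem IsIMAG.redirect_colliderWalk (hM : M.IsIMAG) (hd : d ∈ M.outputs)
    (hdu : M.Directed d u) (hv : ¬ M.Visible d u) {a x : α} {m n : Mark}
    (w : M.ColliderWalk P x m n a) (hm : m = Mark.arrow) (hxu : M.Directed x u)
    (hx : x = d ∨ M.ColliderWalk (fun v => M.Directed v u) x Mark.arrow Mark.arrow d) :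
    ∃ k, M.ColliderWalk P u Mark.arrow k a := by
  induction w with
  | edge e =>
    subst hm
    obtain ⟨⟨k, e'⟩, -⟩ := hM.exists_edge_of_not_visible hd hdu hv (M.edge_symm e) hxu hx
    exact ⟨k, .edge (M.edge_symm e')⟩
  | cons e hP w ih =>
    subst hm
    obtain ⟨⟨k, e'⟩, w'⟩ := hM.exists_edge_of_not_visible hd hdu hv (M.edge_symm e) hxu hx
    rcases hM.tail_or_arrow e' with rfl | rfl
    · exact ih rfl e' (Or.inr w')
    · exact ⟨_, .cons (M.edge_symm e') hP w⟩

/-- A collider walk from `a` via `d` and `u` to `b` that uses an additional edge `d ↔ u` makes its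
endnodes adjacent, provided that `d — u` or that `d → u` is invisible. -/
theorem IsIMAG.adj_of_bridge (hM : M.IsIMAG) (hd : d ∈ M.outputs)
    (hdu : M.Undirected d u ∨ M.Directed d u ∧ ¬ M.Visible d u) {a b : α} (ha : a ∈ M.nodes)
    (hb : b ∈ M.nodes) (hab : a ≠ b)
    (hP : ∀ v c, M.ArrowAt v c → P v → v ∈ M.Anc ({a, b} ∪ ∅))
    (hL : a = d ∨ P d ∧ ∃ k, M.ColliderWalk P d Mark.arrow k a)
    (hR : u = b ∨ P u ∧ ∃ k, M.ColliderWalk P u Mark.arrow k b) : M.Adj a b := by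
  rcases hdu with hdu | ⟨hdu, hv⟩
  · obtain rfl : a = d := by
      refine hL.resolve_right ?_
      rintro ⟨-, k, w⟩
      obtain ⟨k', v, e⟩ := w.exists_edge_left
      exact hM.no_arrow_undirected _ _ _ ⟨_, e⟩ hdu
    obtain rfl : u = b := by
      refine hR.resolve_right ?_
      rintro ⟨-, k, w⟩
      obtain ⟨k', v, e⟩ := w.exists_edge_left
      exact hM.no_arrow_undirected _ _ _ ⟨_, e⟩ (M.edge_symm hdu)
    exact ⟨_, _, hdu⟩
  · have hua : ∃ k, M.ColliderWalk P u Mark.arrow k a := by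
      rcases hL with rfl | ⟨-, k, w⟩
      · exact ⟨_, .edge (M.edge_symm hdu)⟩
      · exact hM.redirect_colliderWalk hd hdu hv w rfl hdu (Or.inl rfl)
    obtain ⟨k, w⟩ := hua
    have hw : ∃ k k', M.ColliderWalk P a k k' b := by
      rcases hR with rfl | ⟨hPu, k', w'⟩
      · exact ⟨_, _, w.symm⟩
      · exact ⟨_, _, w.symm.trans hPu w'⟩
    obtain ⟨k, k', w⟩ := hw
    by_contra hadj
    exact hM.maximal a ha b hb hab hadj ((w.mono hP).hasInducingPath hab)

end Bridge

/-- Labels `f a b = f b a`, different from the nodes of `M`, for a selection node between any two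
nodes `a`, `b` of `M`. -/
structure SelLabels (M : MixedGraph α) where
  f : α → α → α
  comm : ∀ a b, f a b = f b a
  notMem : ∀ {a b}, a ∈ M.nodes → b ∈ M.nodes → f a b ∉ M.nodes
  inj : ∀ {a b c d}, a ∈ M.nodes → b ∈ M.nodes → c ∈ M.nodes → d ∈ M.nodes → f a b = f c d →
    a = c ∧ b = d ∨ a = d ∧ b = c

theorem nonempty_selLabels [Infinite α] (M : MixedGraph α) : Nonempty M.SelLabels := by
  have hfin : M.nodes.Finite := M.finite_inputs.union M.finite_outputs
  have hfin2 : ((fun p : α × α => s(p.1, p.2)) '' (M.nodes ×ˢ M.nodes)).Finite :=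
    (hfin.prod hfin).image _
  have hinf : (M.nodesᶜ).encard = ⊤ := hfin.infinite_compl.encard_eq
  obtain ⟨g, hg, hinj⟩ := hfin2.exists_injOn_of_encard_le (t := M.nodesᶜ) (by simp [hinf])
  refine ⟨⟨fun a b => g s(a, b), fun a b => by rw [Sym2.eq_swap], ?_, ?_⟩⟩
  · intro a b ha hb
    exact hg ⟨(a, b), ⟨ha, hb⟩, rfl⟩
  · intro a b c d ha hb hc hd h
    have := hinj ⟨(a, b), ⟨ha, hb⟩, rfl⟩ ⟨(c, d), ⟨hc, hd⟩, rfl⟩ h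
    simpa using this

/-- `E` selects at most one pair `d`, `u`, and this pair has an edge `d — u` or an invisible edge
`d → u`. -/
structure Confoundable (M : MixedGraph α) (E : α → α → Prop) : Prop where
  mem : ∀ {d u}, E d u → d ∈ M.outputs ∧ u ∈ M.outputs
  edge : ∀ {d u}, E d u → M.Undirected d u ∨ M.Directed d u ∧ ¬ M.Visible d u
  unique : ∀ {d u d' u'}, E d u → E d' u' → d = d' ∧ u = u'

theorem Confoundable.ne {M : MixedGraph α} {E : α → α → Prop} (hE : M.Confoundable E) {d u : α}
    (h : E d u) : d ≠ u := by
  rcases hE.edge h with h | h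
  · exact M.edge_ne h
  · exact M.edge_ne h.1

/-- The graph that arises from `M` by replacing every undirected edge `a — b` by a selection node
with edges `a → f a b ← b`, and by adding an edge `d ↔ u` if `E d u`. -/
def canonGraph (M : MixedGraph α) (s : M.SelLabels) (E : α → α → Prop) (hE : M.Confoundable E) :
    MixedGraph α where
  inputs := M.inputs
  outputs := M.outputs ∪ {x | ∃ a b, M.Undirected a b ∧ x = s.f a b}
  edge a m n b := (M.edge a m n b ∧ ¬ (m = Mark.tail ∧ n = Mark.tail)) ∨
    (m = Mark.arrow ∧ n = Mark.arrow ∧ (E a b ∨ E b a)) ∨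
    (m = Mark.tail ∧ n = Mark.arrow ∧ ∃ c, M.Undirected a c ∧ b = s.f a c) ∨
    (m = Mark.arrow ∧ n = Mark.tail ∧ ∃ c, M.Undirected b c ∧ a = s.f b c)
  finite_inputs := M.finite_inputs
  finite_outputs := by
    have hfin : M.nodes.Finite := M.finite_inputs.union M.finite_outputs
    refine M.finite_outputs.union ((hfin.image2 s.f hfin).subset ?_)
    rintro _ ⟨a, b, h, rfl⟩
    exact ⟨a, M.edge_mem h, b, M.edge_mem (M.edge_symm h), rfl⟩
  disjoint := by
    rw [Set.disjoint_left]
    rintro _ hI (hO | ⟨a, b, h, rfl⟩)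
    · exact Set.disjoint_left.1 M.disjoint hI hO
    · exact s.notMem (M.edge_mem h) (M.edge_mem (M.edge_symm h)) (Or.inl hI)
  edge_symm := by
    rintro a m n b (⟨h, h'⟩ | ⟨h, h', h''⟩ | ⟨h, h', h''⟩ | ⟨h, h', h''⟩)
    · exact Or.inl ⟨M.edge_symm h, fun h => h' ⟨h.2, h.1⟩⟩
    · exact Or.inr (Or.inl ⟨h', h, h''.symm⟩)
    · exact Or.inr (Or.inr (Or.inr ⟨h', h, h''⟩))
    · exact Or.inr (Or.inr (Or.inl ⟨h', h, h''⟩))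
  edge_ne := by
    rintro a m n b (⟨h, -⟩ | ⟨-, -, h | h⟩ | ⟨-, -, c, h, rfl⟩ | ⟨-, -, c, h, rfl⟩) hab
    · exact M.edge_ne h hab
    · exact hE.ne h hab
    · exact hE.ne h hab.symm
    · exact s.notMem (M.edge_mem h) (M.edge_mem (M.edge_symm h)) (hab ▸ M.edge_mem h)
    · exact s.notMem (M.edge_mem h) (M.edge_mem (M.edge_symm h)) (hab.symm ▸ M.edge_mem h)
  edge_mem := by
    rintro a m n b (⟨h, -⟩ | ⟨-, -, h | h⟩ | ⟨-, -, c, h, rfl⟩ | ⟨-, -, c, h, rfl⟩)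
    · exact (M.edge_mem h).imp id Or.inl
    · exact Or.inr (Or.inl (hE.mem h).1)
    · exact Or.inr (Or.inl (hE.mem h).2)
    · exact (M.edge_mem h).imp id Or.inl
    · exact Or.inr (Or.inr ⟨_, _, h, rfl⟩)

section Canon

variable {M : MixedGraph α} {s : M.SelLabels} {E : α → α → Prop} {hE : M.Confoundable E}

theorem Undirected.f_notMem {a b : α} (h : M.Undirected a b) : s.f a b ∉ M.nodes :=
  s.notMem (M.edge_mem h) (M.edge_mem (M.edge_symm h))

theorem canonGraph_edge_of_mem {a b : α} {m n : Mark} (ha : a ∈ M.nodes) (hb : b ∈ M.nodes)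
    (h : (M.canonGraph s E hE).edge a m n b) :
    M.edge a m n b ∨ (m = Mark.arrow ∧ n = Mark.arrow ∧ (E a b ∨ E b a)) := by
  rcases h with ⟨h, -⟩ | h | ⟨-, -, c, h, rfl⟩ | ⟨-, -, c, h, rfl⟩
  · exact Or.inl h
  · exact Or.inr h
  · exact absurd hb h.f_notMem
  · exact absurd ha h.f_notMem

theorem canonGraph_edge_of_notMem {a b : α} {m n : Mark} (hb : b ∉ M.nodes)
    (h : (M.canonGraph s E hE).edge a m n b) :
    m = Mark.tail ∧ n = Mark.arrow ∧ ∃ c, M.Undirected a c ∧ b = s.f a c := by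
  rcases h with ⟨h, -⟩ | ⟨-, -, h | h⟩ | h | ⟨-, -, c, h, rfl⟩
  · exact absurd (M.edge_mem (M.edge_symm h)) hb
  · exact absurd (Or.inr (hE.mem h).2) hb
  · exact absurd (Or.inr (hE.mem h).1) hb
  · exact h
  · exact absurd (M.edge_mem h) hb

/-- Directed paths of the canonical graph are directed paths of `M`, possibly followed by an edge to
a selection node. -/
theorem canonGraph_reach {a x : α} (ha : a ∈ M.nodes)
    (h : Relation.ReflTransGen (M.canonGraph s E hE).Directed a x) :
    (x ∈ M.nodes ∧ Relation.ReflTransGen M.Directed a x) ∨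
      (x ∉ M.nodes ∧ ∃ b c, Relation.ReflTransGen M.Directed a b ∧ M.Undirected b c) := by
  induction h with
  | refl => exact Or.inl ⟨ha, .refl⟩
  | @tail y z _ e ih =>
    rcases e with ⟨e, -⟩ | ⟨h, -⟩ | ⟨-, -, c, e, rfl⟩ | ⟨h, -⟩
    · rcases ih with ih | ih
      · exact Or.inl ⟨M.edge_mem (M.edge_symm e), ih.2.tail e⟩
      · exact absurd (M.edge_mem e) ih.1
    · cases h
    · rcases ih with ih | ih
      · exact Or.inr ⟨e.f_notMem, y, c, ih.2, e⟩
      · exact absurd (M.edge_mem e) ih.1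
    · cases h

theorem canonGraph_isIADMG (hM : M.IsIMAG) : (M.canonGraph s E hE).IsIADMG where
  edge_type := by
    rintro a m n b (⟨h, h'⟩ | ⟨rfl, rfl, -⟩ | ⟨rfl, rfl, -⟩ | ⟨rfl, rfl, -⟩)
    · rcases hM.tail_or_arrow h with rfl | rfl <;>
        rcases hM.tail_or_arrow (M.edge_symm h) with rfl | rfl <;> simp_all
    · simp
    · simp
    · simp
  no_arrow_input := by
    rintro a b ha ⟨n, ⟨h, -⟩ | ⟨-, -, h | h⟩ | ⟨h, -⟩ | ⟨-, -, c, h, rfl⟩⟩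
    · exact hM.no_arrow_input ha ⟨_, h⟩
    · exact Set.disjoint_left.1 M.disjoint ha (hE.mem h).1
    · exact Set.disjoint_left.1 M.disjoint ha (hE.mem h).2
    · cases h
    · exact h.f_notMem (Or.inl ha)
  acyclic := by
    intro a h
    obtain ⟨y, e, h⟩ := Relation.TransGen.head'_iff.1 h
    have ha : a ∈ M.nodes := by
      rcases e with ⟨e, -⟩ | ⟨h, -⟩ | ⟨-, -, c, e, -⟩ | ⟨h, -⟩
      · exact M.edge_mem e
      · cases h
      · exact M.edge_mem e
      · cases h
    rcases e with ⟨e, -⟩ | ⟨h, -⟩ | ⟨-, -, c, e, rfl⟩ | ⟨h, -⟩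
    · rcases canonGraph_reach (M.edge_mem (M.edge_symm e)) h with h | h
      · exact hM.no_directed_cycle a (.head' e h.2)
      · exact h.1 ha
    · cases h
    · rcases h.cases_head with h | ⟨z, e', -⟩
      · exact e.f_notMem (h ▸ ha)
      · rcases e' with ⟨e', -⟩ | ⟨h, -⟩ | ⟨-, -, c, e', -⟩ | ⟨h, -⟩
        · exact e.f_notMem (M.edge_mem e')
        · cases h
        · exact e.f_notMem (M.edge_mem e')
        · cases h
    · cases h

/-- The canonical graph of an iMAG, as a graph with selection nodes. -/
def canon (M : MixedGraph α) (hM : M.IsIMAG) (s : M.SelLabels) (E : α → α → Prop)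
    (hE : M.Confoundable E) : ISADMG α where
  graph := M.canonGraph s E hE
  isIADMG := canonGraph_isIADMG hM
  sel := {x | ∃ a b, M.Undirected a b ∧ x = s.f a b}
  sel_subset := Set.subset_union_right

/-- The ancestors of selection nodes are the nodes with undirected edges, as these nodes have no
arrowheads. -/
theorem canon_anc_sel {hM : M.IsIMAG} {a : α} (ha : a ∈ M.nodes) :
    a ∈ (M.canon hM s E hE).graph.Anc (M.canon hM s E hE).sel ↔ ∃ c, M.Undirected a c := by
  constructor
  · rintro ⟨x, ⟨b, c, hbc, rfl⟩, h⟩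
    rcases canonGraph_reach (hE := hE) ha h with h | ⟨-, b', c', h, h'⟩
    · exact absurd h.1 hbc.f_notMem
    · rcases h.cases_tail with rfl | ⟨y, -, e⟩
      · exact ⟨c', h'⟩
      · exact absurd h' (hM.no_arrow_undirected _ _ _ ⟨_, M.edge_symm e⟩)
  · rintro ⟨c, h⟩
    exact ⟨_, ⟨a, c, h, rfl⟩, .single (Or.inr (Or.inr (Or.inl ⟨rfl, rfl, c, h, rfl⟩)))⟩

theorem canon_ancTo {hM : M.IsIMAG} {a b c : α} (ha : M.ArrowAt a c) (hb : b ∈ M.nodes)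
    (h : (M.canon hM s E hE).graph.AncTo (M.canon hM s E hE).sel a b) :
    Relation.ReflTransGen M.Directed a b := by
  obtain ⟨n, e⟩ := ha
  rcases ancTo_iff.1 h with h | h
  · exact (canonGraph_reach (hE := hE) (M.edge_mem e) h).elim And.right fun h => absurd hb h.1
  · obtain ⟨x, hx⟩ := (canon_anc_sel (M.edge_mem e)).1 h
    exact absurd hx (hM.no_arrow_undirected _ _ _ ⟨_, e⟩)

/-- Inducing paths of the canonical graph join adjacent nodes: those through a selection node stem
from an undirected edge, those through the additional edge are redirected, and all others are
inducing paths of `M`, which is maximal. -/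
theorem canon_adj (hM : M.IsIMAG) {a b : α} (ha : a ∈ M.nodes) (hb : b ∈ M.nodes) (hab : a ≠ b)
    (h : (M.canon hM s E hE).graph.HasInducingPath (M.canon hM s E hE).sel a b) : M.Adj a b := by
  obtain ⟨π, hpath, hft, hcol⟩ := h
  by_contra hadj
  have hlen : π.length ≠ 0 := fun h0 => hab (hft.1.symm.trans (by rw [← hft.2, h0]))
  -- a selection node on an inducing path lies between its two adjacent parents only
  have hmem : ∀ i ≤ π.length, π.node i ∈ M.nodes := by
    intro i hi
    by_contra hmem
    rcases i with _ | i
    · exact hmem (hft.1 ▸ ha)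
    have hi' : i + 1 < π.length := lt_of_le_of_ne hi fun h => hmem (by rw [h, hft.2]; exact hb)
    obtain ⟨h1, -, c, hc, hic⟩ := canonGraph_edge_of_notMem (hE := hE) hmem (π.edge i (by omega))
    obtain ⟨h2, -, c', hc', hic'⟩ := canonGraph_edge_of_notMem (hE := hE) hmem
      ((M.canonGraph s E hE).edge_symm (π.edge (i + 1) hi'))
    have h0 : i = 0 := by
      rcases i with _ | j
      · rfl
      · have := (hcol j (by omega)).1.2
        rw [h1] at this
        cases this
    subst h0
    have hl : π.length = 2 := by
      by_contra hl
      have := (hcol 1 (by omega)).1.1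
      rw [h2] at this
      cases this
    have e0 := hft.1
    have e2 := hft.2
    rw [hl] at e2
    rw [e0] at hc hic
    simp only [zero_add, Nat.reduceAdd] at hc' hic'
    rw [e2] at hc' hic'
    rcases s.inj ha (M.edge_mem (M.edge_symm hc)) hb (M.edge_mem (M.edge_symm hc'))
      (hic.symm.trans hic') with h | h
    · exact hab h.1
    · exact hadj ⟨_, _, h.2 ▸ hc⟩
  set P : α → Prop := fun v =>
    v ∈ (M.canon hM s E hE).graph.Anc ({a, b} ∪ (M.canon hM s E hE).sel)
  have hP : ∀ v c, M.ArrowAt v c → P v → v ∈ M.Anc ({a, b} ∪ ∅) := by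
    intro v c hvc hv
    rcases mem_anc_pair_iff.1 hv with hv | hv
    · exact ⟨a, Or.inl (Or.inl rfl), canon_ancTo hvc ha hv⟩
    · exact ⟨b, Or.inl (Or.inr rfl), canon_ancTo hvc hb hv⟩
  have hedge : ∀ i < π.length, M.edge (π.node i) (π.fst i) (π.snd i) (π.node (i + 1)) ∨
      (E (π.node i) (π.node (i + 1)) ∨ E (π.node (i + 1)) (π.node i)) := by
    intro i hi
    exact (canonGraph_edge_of_mem (hE := hE) (hmem i hi.le) (hmem (i + 1) hi) (π.edge i hi)).imp id
      fun h => h.2.2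
  have hcol' : ∀ i, i + 1 < π.length →
      π.snd i = Mark.arrow ∧ π.fst (i + 1) = Mark.arrow ∧ P (π.node (i + 1)) := fun i hi =>
    ⟨(hcol i hi).1.1, (hcol i hi).1.2, (hcol i hi).2⟩
  by_cases hex : ∃ i < π.length, E (π.node i) (π.node (i + 1)) ∨ E (π.node (i + 1)) (π.node i)
  · obtain ⟨i, hi, hEi⟩ := hex
    -- a path uses the additional edge only once
    have hedge' : ∀ j < π.length, j ≠ i →
        M.edge (π.node j) (π.fst j) (π.snd j) (π.node (j + 1)) := by
      intro j hj hji
      refine (hedge j hj).resolve_right fun hEj => hji ?_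
      rcases hEi with hEi | hEi <;> rcases hEj with hEj | hEj
      · exact hpath _ (by omega) _ (by omega) (hE.unique hEj hEi).1
      · have h1 := hpath _ (by omega) _ (by omega) (hE.unique hEj hEi).1
        have h2 := hpath _ (by omega) _ (by omega) (hE.unique hEj hEi).2
        omega
      · have h1 := hpath _ (by omega) _ (by omega) (hE.unique hEj hEi).1
        have h2 := hpath _ (by omega) _ (by omega) (hE.unique hEj hEi).2
        omega
      · exact hpath _ (by omega) _ (by omega) (hE.unique hEj hEi).2
    have hL : a = π.node i ∨
        P (π.node i) ∧ ∃ k, M.ColliderWalk P (π.node i) Mark.arrow k a := by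
      rcases i with _ | i
      · exact Or.inl hft.1.symm
      · refine Or.inr ⟨(hcol' i (by omega)).2.2, π.fst 0, ?_⟩
        have w := colliderWalk_of_segment (G := M) (P := P) π.node π.fst π.snd 0 i
          (fun j _ _ => hedge' j (by omega) (by omega)) (fun j _ _ => hcol' j (by omega))
        rw [hft.1, zero_add, (hcol' i (by omega)).1] at w
        exact w.symm
    have hR : π.node (i + 1) = b ∨
        P (π.node (i + 1)) ∧ ∃ k, M.ColliderWalk P (π.node (i + 1)) Mark.arrow k b := by
      by_cases hil : i + 1 = π.length
      · exact Or.inl (by rw [hil]; exact hft.2)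
      · have hc := hcol' i (by omega)
        refine Or.inr ⟨hc.2.2, π.snd (i + 1 + (π.length - i - 2)), ?_⟩
        have w := colliderWalk_of_segment (G := M) (P := P) π.node π.fst π.snd (i + 1)
          (π.length - i - 2)
          (fun j _ _ => hedge' j (by omega) (by omega)) (fun j _ _ => hcol' j (by omega))
        rw [hc.2.1, show i + 1 + (π.length - i - 2) + 1 = π.length by omega, hft.2] at w
        exact w
    rcases hEi with hEi | hEi
    · exact hadj (hM.adj_of_bridge (hE.mem hEi).1 (hE.edge hEi) ha hb hab hP hL hR)
    · have hP' : ∀ v c, M.ArrowAt v c → P v → v ∈ M.Anc ({b, a} ∪ ∅) := by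
        rwa [Set.pair_comm b a]
      obtain ⟨m, n, e⟩ := hM.adj_of_bridge (hE.mem hEi).1 (hE.edge hEi) hb ha hab.symm hP'
        (hR.imp Eq.symm id) (hL.imp Eq.symm id)
      exact hadj ⟨_, _, M.edge_symm e⟩
  · have w := colliderWalk_of_segment (G := M) (P := P) π.node π.fst π.snd 0 (π.length - 1)
      (fun j _ _ => (hedge j (by omega)).resolve_right fun h => hex ⟨j, by omega, h⟩)
      (fun j _ _ => hcol' j (by omega))
    rw [show 0 + (π.length - 1) + 1 = π.length by omega, hft.1, hft.2] at w
    exact hM.maximal a ha b hb hab hadj ((w.mono hP).hasInducingPath hab)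

theorem represents_canon (hM : M.IsIMAG) : M.Represents (M.canon hM s E hE) where
  inputs_eq := rfl
  outputs_eq := by
    ext x
    constructor
    · intro hx
      refine ⟨Or.inl hx, ?_⟩
      rintro ⟨a, b, h, rfl⟩
      exact h.f_notMem (Or.inr hx)
    · rintro ⟨hx | hx, hx'⟩
      · exact hx
      · exact absurd hx hx'
  adj_iff := by
    intro a ha b hb hab
    refine ⟨?_, fun h => canon_adj hM ha hb hab h.2⟩
    rintro ⟨m, n, e⟩
    refine ⟨fun hI => hM.no_edge_input hI.1 hI.2 ⟨_, _, e⟩, ?_⟩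
    by_cases hmn : m = Mark.tail ∧ n = Mark.tail
    · obtain ⟨rfl, rfl⟩ := hmn
      have hu : M.Undirected a b := e
      refine ColliderWalk.hasInducingPath (m := Mark.tail) (n := Mark.tail)
        (.cons (v := s.f a b) (Or.inr (Or.inr (Or.inl ⟨rfl, rfl, b, hu, rfl⟩)))
          ⟨_, Or.inr ⟨a, b, hu, rfl⟩, .refl⟩
          (.edge (Or.inr (Or.inr (Or.inr ⟨rfl, rfl, a, M.edge_symm hu, s.comm a b⟩))))) hab
    · exact ColliderWalk.hasInducingPath (.edge (Or.inl ⟨e, hmn⟩)) hab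
  arrow := by
    rintro a b ⟨n, e⟩ h
    have h := canon_ancTo (c := b) ⟨n, e⟩ (M.edge_mem (M.edge_symm e)) h
    rcases Relation.reflTransGen_iff_eq_or_transGen.1 h with h | h
    · exact M.edge_ne e h.symm
    · rcases hM.tail_or_arrow (M.edge_symm e) with rfl | rfl
      · exact hM.no_directed_cycle a (h.tail (M.edge_symm e))
      · exact hM.no_almost_directed_cycle a b h (M.edge_symm e)
  tail := by
    rintro a b ⟨n, e⟩
    rcases hM.tail_or_arrow (M.edge_symm e) with rfl | rfl
    · exact AncTo.of_anc ((canon_anc_sel (M.edge_mem e)).2 ⟨b, e⟩)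
    · exact AncTo.of_directed (Or.inl ⟨e, by simp⟩)

end Canon

/-! ### From the iMAG to a canonical representative -/

section Completeness

variable {M : MixedGraph α} {s : M.SelLabels} {D T : Set α}

theorem confoundable_false (M : MixedGraph α) : M.Confoundable fun _ _ => False :=
  ⟨False.elim, False.elim, fun h => h.elim⟩

theorem confoundable_pair {d u : α} (hd : d ∈ M.outputs) (hu : u ∈ M.outputs)
    (h : M.Undirected d u ∨ M.Directed d u ∧ ¬ M.Visible d u) :
    M.Confoundable fun x y => x = d ∧ y = u := by
  refine ⟨?_, ?_, ?_⟩
  · rintro _ _ ⟨rfl, rfl⟩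
    exact ⟨hd, hu⟩
  · rintro _ _ ⟨rfl, rfl⟩
    exact h
  · rintro _ _ _ _ ⟨rfl, rfl⟩ ⟨rfl, rfl⟩
    exact ⟨rfl, rfl⟩

section Transfer

variable {E : α → α → Prop} {hE : M.Confoundable E}

theorem base_notMem_inputs_canon {a : α} (haI : a ∉ M.inputs) (haT : a ∉ T) :
    Node.base a ∉ ((M.canonGraph s E hE).doADMG D T).inputs :=
  base_notMem_inputs_doADMG.2 ⟨haI, fun h => absurd h haT⟩

theorem not_mem_of_notMem_inputs_doMAG (hT : T ⊆ M.outputs) {a : α}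
    (ha : Node.base a ∉ (M.doMAG D T).inputs) : a ∉ M.inputs ∧ a ∉ T := by
  obtain ⟨h1, h2⟩ := base_notMem_inputs_doMAG.1 ha
  exact ⟨h1, fun h => h2 h (hT h)⟩

theorem Undirected.f_notMem_inputs_canon (hT : T ⊆ M.outputs) {a b : α} (h : M.Undirected a b) :
    Node.base (s.f a b) ∉ ((M.canonGraph s E hE).doADMG D T).inputs :=
  base_notMem_inputs_doADMG.2 ⟨fun hI => h.f_notMem (Or.inl hI),
    fun hT' => absurd (Or.inr (hT hT')) h.f_notMem⟩

theorem Undirected.edge_f_canon (hT : T ⊆ M.outputs) {a b : α} (h : M.Undirected a b) :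
    ((M.canonGraph s E hE).doADMG D T).edge (.base a) .tail .arrow (.base (s.f a b)) := by
  refine ⟨Or.inr (Or.inr (Or.inl ⟨rfl, rfl, b, h, rfl⟩)), ?_, by simp⟩
  rintro ⟨hT', -⟩
  exact h.f_notMem (Or.inr (hT (base_mem_image.1 hT')))

theorem edge_canon_of_doMAG (hM : M.IsIMAG) (hT : T ⊆ M.outputs) {a b : α} {m n : Mark}
    (e : (M.doMAG D T).edge (.base a) m n (.base b)) (hmn : ¬ (m = Mark.tail ∧ n = Mark.tail)) :
    ((M.canonGraph s E hE).doADMG D T).edge (.base a) m n (.base b) := by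
  have key : ∀ {a b : α} {m n : Mark}, (M.doMAG D T).edge (.base a) m n (.base b) →
      ¬ (Node.base a ∈ Node.base '' T ∧ m = Mark.arrow) := by
    rintro a b m n e ⟨hT', rfl⟩
    have ha := base_mem_image.1 hT'
    have := (tame_doMAG hM D hT).tail_of_input e (Or.inr ⟨hT', a, hT ha, rfl⟩)
    cases this
  exact ⟨Or.inl ⟨e.1, hmn⟩, key ((M.doMAG D T).edge_symm e), key e⟩

theorem anc_canon_of_doMAG (hM : M.IsIMAG) (hT : T ⊆ M.outputs) {X Y : Set (Node α)} {a : α}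
    (hXY : X ⊆ Y) (h : .base a ∈ (M.doMAG D T).Anc X) :
    .base a ∈ ((M.canonGraph s E hE).doADMG D T).Anc Y := by
  obtain ⟨x, hx, h⟩ := h
  generalize hy : Node.base a = y at h
  induction h using Relation.ReflTransGen.head_induction_on generalizing a with
  | refl =>
    subst hy
    exact ⟨_, hXY hx, .refl⟩
  | @head y z e _ ih =>
    subst hy
    rcases z with b | d
    · exact anc_trans (.single (edge_canon_of_doMAG hM hT e (by simp))) (ih rfl)
    · exact absurd e.1.2.1 (by simp)

/-- The selection nodes of the canonical graph lie in the conditioning set. -/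
theorem Undirected.openAt_f_canon {hM : M.IsIMAG} {C : Set (Node α)} {a b : α}
    (h : M.Undirected a b) : ((M.canonGraph s E hE).doADMG D T).OpenAt
      (C ∪ Node.base '' T ∪ Node.base '' (M.canon hM s E hE).sel)
      (Node.base '' (M.canonGraph s E hE).outputs) (.base (s.f a b)) .arrow .arrow :=
  Or.inr ⟨rfl, rfl, _, ⟨Or.inr ⟨_, ⟨a, b, h, rfl⟩, rfl⟩, ⟨_, Or.inr ⟨a, b, h, rfl⟩, rfl⟩⟩, .refl⟩

theorem openTo_canon_edge (hM : M.IsIMAG) (hT : T ⊆ M.outputs) {C : Set (Node α)} {a b : α}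
    {m n : Mark} (ha : .base a ∉ (M.doMAG D T).inputs)
    (e : (M.doMAG D T).edge (.base a) m n (.base b)) :
    ((M.canonGraph s E hE).doADMG D T).OpenTo
      (C ∪ Node.base '' T ∪ Node.base '' (M.canon hM s E hE).sel)
      (Node.base '' (M.canonGraph s E hE).outputs) (.base b) (.base a) m := by
  obtain ⟨haI, haT⟩ := not_mem_of_notMem_inputs_doMAG hT ha
  have haA := base_notMem_inputs_canon (s := s) (hE := hE) (D := D) haI haT
  by_cases hmn : m = Mark.tail ∧ n = Mark.tail
  · obtain ⟨rfl, rfl⟩ := hmn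
    have hu : M.Undirected a b := e.1
    have hu' : M.Undirected b a := M.edge_symm hu
    refine .cons haA (hu.edge_f_canon hT) hu.openAt_f_canon
      (.edge (n := .tail) (hu.f_notMem_inputs_canon hT) ?_)
    rw [s.comm]
    exact MixedGraph.edge_symm _ (hu'.edge_f_canon hT)
  · exact .edge haA (edge_canon_of_doMAG hM hT e hmn)

theorem openTo_canon_cons (hM : M.IsIMAG) (hT : T ⊆ M.outputs) {C : Set (Node α)} {a b : α}
    {m n m' : Mark} {t : Node α} (ha : .base a ∉ (M.doMAG D T).inputs)
    (e : (M.doMAG D T).edge (.base a) m n (.base b))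
    (hb : ((M.canonGraph s E hE).doADMG D T).OpenAt
      (C ∪ Node.base '' T ∪ Node.base '' (M.canon hM s E hE).sel)
      (Node.base '' (M.canonGraph s E hE).outputs) (.base b) n m')
    (w : ((M.canonGraph s E hE).doADMG D T).OpenTo
      (C ∪ Node.base '' T ∪ Node.base '' (M.canon hM s E hE).sel)
      (Node.base '' (M.canonGraph s E hE).outputs) t (.base b) m') :
    ((M.canonGraph s E hE).doADMG D T).OpenTo
      (C ∪ Node.base '' T ∪ Node.base '' (M.canon hM s E hE).sel)
      (Node.base '' (M.canonGraph s E hE).outputs) t (.base a) m := by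
  obtain ⟨haI, haT⟩ := not_mem_of_notMem_inputs_doMAG hT ha
  have haA := base_notMem_inputs_canon (s := s) (hE := hE) (D := D) haI haT
  by_cases hmn : m = Mark.tail ∧ n = Mark.tail
  · obtain ⟨rfl, rfl⟩ := hmn
    have hu : M.Undirected a b := e.1
    have hu' : M.Undirected b a := M.edge_symm hu
    refine .cons haA (hu.edge_f_canon hT) hu.openAt_f_canon
      (.cons (n := .tail) (hu.f_notMem_inputs_canon hT) ?_ hb w)
    rw [s.comm]
    exact MixedGraph.edge_symm _ (hu'.edge_f_canon hT)
  · exact .cons haA (edge_canon_of_doMAG hM hT e hmn) hb w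

theorem edge_int_canon (hDT : Disjoint D T) {d : α} (hd : d ∈ D) (hdM : d ∈ M.outputs) :
    ((M.canonGraph s E hE).doADMG D T).edge (.base d) .arrow .tail (.int d) := by
  refine ⟨softADMG_edge_int.2 ⟨⟨hd, Or.inl hdM⟩, rfl, Or.inl hdM, rfl, rfl⟩, by simp, ?_⟩
  rintro ⟨hT, -⟩
  exact Set.disjoint_left.1 hDT hd (base_mem_image.1 hT)

end Transfer

/-- A node with an undirected edge has no arrowheads, also after a manipulation. -/
theorem Undirected.not_arrow_doMAG (hM : M.IsIMAG) {a c : α} (h : M.Undirected a c) {n : Mark}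
    {x : Node α} : ¬ (M.doMAG D T).edge (.base a) .arrow n x := by
  intro e
  rcases x with x | x
  · exact hM.no_arrow_undirected _ _ _ ⟨_, e.1⟩ h
  · obtain ⟨y, hy⟩ := SoftEdge.arrowAt e.1.2.2
    exact hM.no_arrow_undirected _ _ _ hy h

/-- The last edge of an open walk in the manipulated iMAG determines a canonical graph in which the
edge can be replaced by an open walk.  An edge between `I_d` and `u ≠ d` requires the additional
edge `d ↔ u`, as the node `d` is passed as a collider if it is in the conditioning set. -/
theorem exists_openTo_canon_of_edge (hM : M.IsIMAG) (hT : T ⊆ M.outputs) (hDT : Disjoint D T)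
    {C : Set (Node α)} {b : Node α} {a : α} {m n : Mark} (ha : .base a ∉ (M.doMAG D T).inputs)
    (e : (M.doMAG D T).edge (.base a) m n b) :
    ∃ (E : α → α → Prop) (hE : M.Confoundable E) (m' : Mark),
      ((M.canonGraph s E hE).doADMG D T).OpenTo
        (C ∪ Node.base '' T ∪ Node.base '' (M.canon hM s E hE).sel)
        (Node.base '' (M.canonGraph s E hE).outputs) b (.base a) m' ∧
      (m = m' ∨ m' = Mark.arrow ∧ ∀ n x, ¬ (M.doMAG D T).edge (.base a) .arrow n x) := by
  obtain ⟨haI, haT⟩ := not_mem_of_notMem_inputs_doMAG hT ha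
  rcases b with b | d
  · exact ⟨_, confoundable_false M, m, openTo_canon_edge hM hT ha e, Or.inl rfl⟩
  obtain ⟨⟨hd, hdM⟩, rfl, haM, hsoft⟩ := softMAG_edge_int.1 e.1
  have hdI : d ∉ M.inputs := fun h => Set.disjoint_left.1 M.disjoint h hdM
  have hdT : d ∉ T := fun h => Set.disjoint_left.1 hDT hd h
  have hself : ∀ {E} {hE : M.Confoundable E}, ((M.canonGraph s E hE).doADMG D T).OpenTo
      (C ∪ Node.base '' T ∪ Node.base '' (M.canon hM s E hE).sel)
      (Node.base '' (M.canonGraph s E hE).outputs) (.int d) (.base d) .arrow := fun {E hE} =>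
    .edge (base_notMem_inputs_canon hdI hdT) (edge_int_canon hDT hd hdM)
  -- the edge `a ↔ d` for the additional pair
  have hextra : ∀ {hE : M.Confoundable fun x y => x = d ∧ y = a},
      ((M.canonGraph s _ hE).doADMG D T).edge (.base a) .arrow .arrow (.base d) := fun {hE} =>
    ⟨Or.inr (Or.inl ⟨rfl, rfl, Or.inr ⟨rfl, rfl⟩⟩), by simpa using hdT, by simpa using haT⟩
  rcases hsoft with ⟨rfl, rfl, -⟩ | ⟨rfl, rfl, c, hc⟩ | ⟨rfl, rfl, -⟩ | ⟨rfl, hda, hv⟩ | ⟨rfl, hda⟩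
  · exact ⟨_, confoundable_false M, _, hself, Or.inl rfl⟩
  · exact ⟨_, confoundable_false M, _, hself, Or.inr ⟨rfl, fun _ _ => hc.not_arrow_doMAG hM⟩⟩
  · exact ⟨_, confoundable_false M, _, hself,
      Or.inr ⟨rfl, fun _ _ => (tame_doMAG hM D hT).not_arrow_of_circle e⟩⟩
  · refine ⟨_, confoundable_pair hdM haM (Or.inr ⟨hda, hv⟩), .arrow, ?_, Or.inl rfl⟩
    by_cases hdC : Node.base d ∈ C
    · exact .cons (base_notMem_inputs_canon haI haT) hextra (Or.inr ⟨rfl, rfl, _,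
        ⟨Or.inl (Or.inl hdC), d, Or.inl hdM, rfl⟩, .refl⟩) hself
    · refine .cons (n := .tail) (v := .base d) (base_notMem_inputs_canon haI haT)
        ⟨Or.inl ⟨M.edge_symm hda, by simp⟩, by simp, by simpa using haT⟩
        (Or.inl ⟨Or.inl rfl, ?_⟩) hself
      rintro ((h | h) | h)
      · exact hdC h
      · exact hdT (base_mem_image.1 h)
      · exact (represents_canon hM).notMem_sel (Or.inr hdM) (base_mem_image.1 h)
  · refine ⟨_, confoundable_pair hdM haM (Or.inl hda), .arrow, ?_, Or.inr ⟨rfl, fun _ _ =>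
      Undirected.not_arrow_doMAG hM (M.edge_symm hda)⟩⟩
    refine .cons (base_notMem_inputs_canon haI haT) hextra (Or.inr ⟨rfl, rfl, _,
      ⟨Or.inr ⟨_, ⟨d, a, hda, rfl⟩, rfl⟩, ⟨_, Or.inr ⟨d, a, hda, rfl⟩, rfl⟩⟩, ?_⟩) hself
    exact .single (Undirected.edge_f_canon hT hda)

/-- An open walk of the manipulated iMAG gives an open walk with the same endnodes of a manipulated
canonical graph.  Its first mark can change only at a node without arrowheads. -/
theorem exists_openTo_canon (hM : M.IsIMAG) (hT : T ⊆ M.outputs) (hDT : Disjoint D T)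
    {C : Set (Node α)} {a b : Node α} {m : Mark}
    (w : (M.doMAG D T).OpenTo (C ∪ Node.base '' T) (Node.base '' M.outputs) b a m) :
    ∃ (E : α → α → Prop) (hE : M.Confoundable E) (m' : Mark),
      ((M.canonGraph s E hE).doADMG D T).OpenTo
        (C ∪ Node.base '' T ∪ Node.base '' (M.canon hM s E hE).sel)
        (Node.base '' (M.canonGraph s E hE).outputs) b a m' ∧
      (m = m' ∨ m' = Mark.arrow ∧ ∀ n x, ¬ (M.doMAG D T).edge a .arrow n x) := by
  have hbase : ∀ {x : Node α} {k l y}, x ∉ (M.doMAG D T).inputs → (M.doMAG D T).edge x k l y →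
      ∃ a, x = .base a ∧ a ∈ M.outputs := by
    intro x k l y hx e
    obtain ⟨⟨a, ha, rfl⟩, -⟩ := ((M.doMAG D T).edge_mem e).resolve_left hx
    exact ⟨a, rfl, ha⟩
  induction w with
  | edge ha e =>
    obtain ⟨a, rfl, -⟩ := hbase ha e
    exact exists_openTo_canon_of_edge hM hT hDT ha e
  | @cons a m n v m₁ ha e hv w ih =>
    obtain ⟨E, hE, m', w', hm'⟩ := ih
    obtain ⟨a, rfl, -⟩ := hbase ha e
    have hvI : ∃ k l, v ∉ (M.doMAG D T).inputs ∧ (M.doMAG D T).edge v k l b ∨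
        ∃ y, v ∉ (M.doMAG D T).inputs ∧ (M.doMAG D T).edge v k l y := by
      cases w with
      | edge hv' e' => exact ⟨_, _, Or.inl ⟨hv', e'⟩⟩
      | cons hv' e' _ _ => exact ⟨_, _, Or.inr ⟨_, hv', e'⟩⟩
    obtain ⟨v, rfl, hvM⟩ : ∃ a, v = .base a ∧ a ∈ M.outputs := by
      obtain ⟨k, l, ⟨h1, h2⟩ | ⟨y, h1, h2⟩⟩ := hvI
      · exact hbase h1 h2
      · exact hbase h1 h2
    refine ⟨E, hE, m, openTo_canon_cons hM hT ha e ?_ w', Or.inl rfl⟩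
    have hvZ : .base v ∉ C ∪ Node.base '' T →
        .base v ∉ C ∪ Node.base '' T ∪ Node.base '' (M.canon hM s E hE).sel := by
      rintro h (h' | h')
      · exact h h'
      · exact (represents_canon hM).notMem_sel (Or.inr hvM) (base_mem_image.1 h')
    rcases hm' with rfl | ⟨rfl, hno⟩
    · rcases hv with ⟨hv, hZ⟩ | ⟨h1, h2, hA⟩
      · exact Or.inl ⟨hv, hvZ hZ⟩
      · refine Or.inr ⟨h1, h2, anc_canon_of_doMAG hM hT ?_ hA⟩
        rintro _ ⟨hx, x, hxM, rfl⟩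
        exact ⟨Or.inl hx, x, Or.inl hxM, rfl⟩
    · have hn : n = Mark.tail := by
        rcases hM.tail_or_arrow (M.edge_symm (softMAG_edge_base.1 e.1)) with h | rfl
        · exact h
        · exact absurd ((M.doMAG D T).edge_symm e) (hno _ _)
      rcases hv with ⟨-, hZ⟩ | ⟨h1, -, -⟩
      · exact Or.inl ⟨Or.inl hn, hvZ hZ⟩
      · rw [hn] at h1
        cases h1

end Completeness

end MixedGraph

open MixedGraph

theorem mainTheorem1 {α : Type*} [Infinite α] (M : MixedGraph α) (hM : M.IsIMAG)
    (D T : Set α) (hD : D ⊆ M.outputs) (hT : T ⊆ M.outputs) (hDT : Disjoint D T)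
    (A : Set α) (hA : A ⊆ M.outputs \ T)
    (B C : Set (Node α))
    (hB : B ⊆ Node.base '' M.inputs ∪ Node.int '' D ∪ Node.base '' M.outputs)
    (hC : C ⊆ Node.base '' M.inputs ∪ Node.int '' D ∪ Node.base '' M.outputs)
    (hAB : Disjoint (Node.base '' A) B) (hAC : Disjoint (Node.base '' A) C)
    (hBC : Disjoint B C) :
    M.IdSep D T (M.doMAG D T) (Node.base '' A) B (C ∪ Node.base '' T) ↔
      ∀ 𝔄 : ISADMG α, M.Represents 𝔄 →
        𝔄.graph.IdSep D T (𝔄.graph.doADMG D T) (Node.base '' A) B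
          (C ∪ Node.base '' T ∪ Node.base '' 𝔄.sel) := by
  have hin : ∀ {G : MixedGraph α}, (G.doMAG D T).inputs ⊆
      Node.base '' G.inputs ∪ Node.int '' D ∪ Node.base '' T := by
    rintro G _ ((h | ⟨x, hx, rfl⟩) | ⟨h, -⟩)
    · exact Or.inl (Or.inl h)
    · exact Or.inl (Or.inr ⟨x, hx.1, rfl⟩)
    · exact Or.inr h
  have hA' : ∀ a ∈ Node.base '' A,
      a ∉ B ∪ Node.base '' M.inputs ∪ Node.int '' D ∪ Node.base '' T := by
    rintro _ ⟨a, ha, rfl⟩ (((h | h) | h) | h)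
    · exact Set.disjoint_left.1 hAB ⟨a, ha, rfl⟩ h
    · exact Set.disjoint_left.1 M.disjoint (base_mem_image.1 h) (hA ha).1
    · exact base_notMem_int_image h
    · exact (hA ha).2 (base_mem_image.1 h)
  constructor
  · intro hsep 𝔄 h𝔄
    by_contra hnot
    obtain ⟨a, ha, b, hb, haC, hbC, m, w⟩ := exists_openTo_of_not_idSep
      (tame_doADMG 𝔄.isIADMG D T) Set.sdiff_subset hin (by rwa [h𝔄.inputs_eq]) hnot
    rw [h𝔄.inputs_eq] at hb
    have hab : a ≠ b := by
      rintro rfl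
      exact hA' a ha hb
    obtain ⟨m', w'⟩ := h𝔄.openTo_doMAG hM hD hT hDT hab (fun h => haC (Or.inr h))
      (fun h => hbC (Or.inl (Or.inr h))) (fun h => hbC (Or.inr h)) w
    exact not_idSep_of_openTo ha hb (fun h => haC (Or.inl h)) (fun h => hbC (Or.inl h)) w' hsep
  · intro hall
    by_contra hnot
    obtain ⟨a, ha, b, hb, haC, hbC, m, w⟩ := exists_openTo_of_not_idSep
      (tame_doMAG hM D hT) Set.sdiff_subset hin hA' hnot
    obtain ⟨s⟩ := nonempty_selLabels M
    obtain ⟨E, hE, m', w', -⟩ := exists_openTo_canon (s := s) hM hT hDT w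
    have hrep : M.Represents (M.canon hM s E hE) := represents_canon hM
    refine not_idSep_of_openTo (G := M.canonGraph s E hE) ha hb ?_ ?_ w' (hall _ hrep)
    · rintro (h | h)
      · exact haC h
      · obtain ⟨a, ha, rfl⟩ := ha
        exact hrep.notMem_sel (Or.inr (hA ha).1) (base_mem_image.1 h)
    · rintro (h | h)
      · exact hbC h
      · obtain ⟨x, hx, rfl⟩ := h
        rcases hb with ((hb | hb) | hb) | hb
        · rcases hB hb with (h | h) | h
          · exact hrep.notMem_sel (Or.inl (base_mem_image.1 h)) hx
          · exact base_notMem_int_image h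
          · exact hrep.notMem_sel (Or.inr (base_mem_image.1 h)) hx
        · exact hrep.notMem_sel (Or.inl (base_mem_image.1 hb)) hx
        · exact base_notMem_int_image hb
        · exact hrep.notMem_sel (Or.inr (hT (base_mem_image.1 hb))) hx
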